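/- **Theorem 5 (RMSE bound, standard Monte Carlo SAA).** Setting. Let $(\Omega,\mathcal F,\mathbb P)$ be a probability space, $\mathcal X\subset\mathbb R^d$ a non-empty compact set, $\Theta\subset\mathbb R^s$, $f:\mathcal X\times\Theta\to\mathbb R$ with $f(x,\cdot)$ Borel measurable for every $x\in\mathcal X$, $\mathcal B\subset(0,\infty)$ a set of bias parameters, and $\zeta$, $\zeta_h$ ($h\in\mathcal B$) random vectors on $\Omega$ with values in $\Theta$, with $f(x,\zeta)$ integrable for every $x$. Put $\mathfrak p^*=\min_{x\in\mathcal X}\mathbb E[f(x,\zeta)]$ and $\|Y\|_2=(\mathbb E[Y^2])^{1/2}$. For $h\in\mathcal B$ let $\mathfrak F_h=\{f(x,\cdot)-\mathbb E[f(x,\zeta_h)]:x\in\mathcal X\}$ and $\bar f_h=\sup_{x\in\mathcal X}|f(x,\zeta_h)-\mathbb E[f(x,\zeta_h)]|$. For $v>0$ let $Q_{[\,]}(v,\mathfrak F_h)$ be the least number of $v$-brackets needed to cover $\mathfrak F_h$, where a $v$-bracket $[l,u]$ is the set of all functions $g$ on $\Theta$ with $l\le g\le u$, for functions $l,u$ that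 are square integrable under the law of $\zeta_h$ and satisfy $\|u(\zeta_h)-l(\zeta_h)\|_2<v$. If $\|\bar f_h\|_2>0$ put $$J_h=\int_0^1\sqrt{1+\log Q_{[\,]}\big(v\|\bar f_h\|_2,\mathfrak F_h\big)}\,dv .$$ Assumptions. 1. (Lipschitz) There is a constant $L_f$ with $|f(x_1,\theta)-f(x_2,\theta)|\le L_f\|x_1-x_2\|$ for all $x_1,x_2\in\mathcal X$, $\theta\in\Theta$. 2. (Variance) $\sigma^2:=\sup_{h\in\mathcal B}\mathbb E\big[\sup_{x\in\mathcal X}|f(x,\zeta_h)|^2\big]<\infty$. Claim. Then $J_h<\infty$ for every $h\in\mathcal B$ with $\|\bar f_h\|_2>0$, and there is a finite constant $\mathfrak c_3\ge 0$, independent of $h$ and $N$ (and of $c_1$ and $\alpha$ below), such that the following holds for every $h\in\mathcal B$ and all real $c_1$, $\alpha>0$ that satisfy 3. (Bias) $\sup_{x\in\mathcal X}\big|\mathbb E[f(x,\zeta_h)-f(x,\zeta)]\big|\le c_1h^\alpha$. For every integer $N\ge1$ and all independent copies $\zeta_h^1,\dots,\zeta_h^N$ of $\zeta_h$ on $\Omega$,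 $$\Big\|\min_{x\in\mathcal X}\frac1N\sum_{k=1}^Nf(x,\zeta_h^k)-\mathfrak p^*\Big\|_2\le c_1h^\alpha+\mathfrak c_3\frac{\sigma}{\sqrt N}.$$ Moreover, if $\|\bar f_h\|_2>0$, the same bound holds with $\mathfrak c_3$ replaced by the bracketing-entropy constant $C J_h$, where $C>0$ is a universal constant (independent of the probability space, $d$, $s$, $\mathcal X$, $\Theta$, $f$, $L_f$, $\mathcal B$, $\zeta$, $h$, $c_1$, $\alpha$, $N$ and all the laws involved). -/

import Mathlib

open MeasureTheory ProbabilityTheory Set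
open scoped ENNReal

noncomputable section

/-- The pair `b = (l, u)` is an `ε`-bracket for the norm of `L²(μ)`: both ends lie in `L²(μ)`, and
`‖u - l‖₂ < ε`. -/
def IsL2Bracket {S : Type*} [MeasurableSpace S] (μ : Measure S) (ε : ℝ≥0∞)
    (b : (S → ℝ) × (S → ℝ)) : Prop :=
  MemLp b.1 2 μ ∧ MemLp b.2 2 μ ∧ eLpNorm (b.2 - b.1) 2 μ < ε

/-- The bracketing number of the class `𝓕` for the norm of `L²(μ)`: the least number of
`ε`-brackets that cover `𝓕`, and `⊤` if no finite number does. -/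
def bracketingNumber {S : Type*} [MeasurableSpace S] (μ : Measure S) (ε : ℝ≥0∞)
    (𝓕 : Set (S → ℝ)) : ℕ∞ :=
  sInf {n : ℕ∞ | ∃ T : Finset ((S → ℝ) × (S → ℝ)), (T.card : ℕ∞) = n ∧
    (∀ b ∈ T, IsL2Bracket μ ε b) ∧
    ∀ g ∈ 𝓕, ∃ b ∈ T, ∀ s, b.1 s ≤ g s ∧ g s ≤ b.2 s}

/-- The class `{f(x, ·) - E[f(x, ξ)] : x}` of centred cost functions, where `ξ` has the law `μ`. -/
def centredClass {I S : Type*} [MeasurableSpace S] (μ : Measure S) (f : I → S → ℝ) :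
    Set (S → ℝ) :=
  range fun (x : I) (s : S) => f x s - ∫ t, f x t ∂μ

/-- The norm `‖sup_x |f(x, ξ) - E[f(x, ξ)]|‖₂`, where `ξ` has the law `μ`. -/
def envelopeNorm {I S : Type*} [MeasurableSpace S] (μ : Measure S) (f : I → S → ℝ) : ℝ≥0∞ :=
  (∫⁻ s, (⨆ x : I, ‖f x s - ∫ t, f x t ∂μ‖ₑ) ^ 2 ∂μ) ^ (1 / 2 : ℝ)

/-- The bracketing entropy integral `∫₀¹ √(1 + log Q(v ‖f̄‖₂)) dv`, where `‖f̄‖₂` is the envelope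
norm and `Q` the bracketing number of the class of centred cost functions in `L²(μ)`. -/
def bracketingIntegral {I S : Type*} [MeasurableSpace S] (μ : Measure S) (f : I → S → ℝ) :
    ℝ≥0∞ :=
  ∫⁻ v in Ioc (0 : ℝ) 1,
    (1 + (ENNReal.log (bracketingNumber μ (ENNReal.ofReal v * envelopeNorm μ f)
      (centredClass μ f) : ℝ≥0∞)).toENNReal) ^ (1 / 2 : ℝ)

/-- `σ² = sup_{h ∈ B} E[sup_x |f(x, ζ_h)|²]`, as an extended nonnegative number. -/
def sigmaSq {Ω I S : Type*} [MeasurableSpace Ω] (P : Measure Ω) (f : I → S → ℝ)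
    (B : Set ℝ) (ζh : ℝ → Ω → S) : ℝ≥0∞ :=
  ⨆ h ∈ B, ∫⁻ ω, ⨆ x : I, ‖f x (ζh h ω)‖ₑ ^ 2 ∂P

/-- The optimal value `min_x E[f(x, ζ)]`. -/
def optimalValue {Ω I S : Type*} [MeasurableSpace Ω] (P : Measure Ω) (f : I → S → ℝ)
    (ζ : Ω → S) : ℝ :=
  ⨅ x : I, ∫ ω, f x (ζ ω) ∂P

/-- The sample average optimal value `min_x (1/N) ∑ₖ f(x, ξ k)`, a random variable. -/
def saaValue {Ω I S : Type*} (f : I → S → ℝ) {N : ℕ} (ξ : Fin N → Ω → S) (ω : Ω) : ℝ :=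
  ⨅ x : I, (1 / (N : ℝ)) * ∑ k, f x (ξ k ω)

end

/-!
The optimal values of the sample average problem and of the limit problem differ by at most the bias
plus `sup_x |∑ₖ (f(x, ξₖ) - E f(x, ζ_h))| / N`, so the matter is a maximal inequality in `L²` for the
centred sums of the class `{f(x, ·)}`. This is Ossiander's bracketing theorem, proved here directly
for `L²` norms.

*Finite classes* (`IsIIDSample.exists_dominating_of_finite`). For at most `exp (l²)` functions bounded
by `b` and of `L²` norm at most `r`, the moment generating function of a centred sum is at most
`exp (n θ² r²)` for `|θ| b ≤ 1`; with `θ = min (1 / b) (l / (√n r))` the maximum of the centred sums has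
`L²` norm at most `4 (b l² + √n r l)`.

*Chaining* (`IsBracketChain.exists_dominating`). For each level `p`, intersect the brackets
chosen for a function `g` up to that level, starting with the bracket `[-F, F]` of the envelope. This
yields `l p ≤ g ≤ u p` with `l p` increasing, the widths `u p - l p` decreasing, and the number of
different states at a level at most the product of the bracketing numbers. A point leaves the chain at
the first level at which the width exceeds a threshold of the order of `√n` times the `L²` width over
the root of the entropy. As long as it stays, the links `l (p + 1) - l p` and the widths are bounded
by the preceding threshold, so that the finite inequality applies; where it leaves, the mean of the
width is controlled by Markov's inequality. The brackets themselves serve as approximations of `g`, so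
no representatives of the class are chosen, and since every dominating random variable is a finite
expression in the brackets, the supremum over the class need not be measurable. The sum over the
levels is a Riemann sum of the entropy integral (`sum_le_bracketingIntegral`), and the remainder tends
to `0` as the last level grows.

*Lipschitz classes*. A cubic grid gives nets of cardinality `exp (A + B / δ)`
(`exists_net_card_le_exp`), hence brackets of constant width and logarithms of bracketing numbers of
order `1 + 1 / ε`. The entropy integral is therefore finite, and its product with the envelope norm is
bounded in terms of `σ`, `Lf` and `X` (`bracketingIntegral_le_of_exp_bound`), which gives a constant that
does not depend on `h` although the entropy integral itself may be unbounded in `h`.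
-/

/-! ### Centred sums over an i.i.d. sample -/

/-- `ξ` is an i.i.d. sample of size `n` from the law `μ`, defined on the probability space
`(Ω, P)`. -/
structure IsIIDSample {Ω S : Type*} [MeasurableSpace Ω] [MeasurableSpace S] (P : Measure Ω)
    (μ : Measure S) {n : ℕ} (ξ : Fin n → Ω → S) : Prop where
  aemeasurable : ∀ k, AEMeasurable (ξ k) P
  map_eq : ∀ k, P.map (ξ k) = μ
  indep : iIndepFun ξ P

/-- The centred, unnormalised empirical sum `∑ₖ (g(ξₖ) - ∫ g dμ)`. -/
noncomputable def centredSum {Ω S : Type*} [MeasurableSpace S] (μ : Measure S) {n : ℕ}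
    (ξ : Fin n → Ω → S) (g : S → ℝ) (ω : Ω) : ℝ :=
  ∑ k, (g (ξ k ω) - ∫ s, g s ∂μ)

lemma eLpNorm_two_sq {α : Type*} [MeasurableSpace α] (μ : Measure α) (f : α → ℝ) :
    eLpNorm f 2 μ ^ 2 = ∫⁻ x, ‖f x‖ₑ ^ 2 ∂μ := by
  have := eLpNorm_nnreal_pow_eq_lintegral (f := f) (μ := μ) (p := 2) (by norm_num)
  simpa using this

lemma eLpNorm_two_le_ofReal_iff {α : Type*} [MeasurableSpace α] {μ : Measure α} {f : α → ℝ}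
    {c : ℝ} (hc : 0 ≤ c) :
    eLpNorm f 2 μ ≤ ENNReal.ofReal c ↔ ∫⁻ x, ‖f x‖ₑ ^ 2 ∂μ ≤ ENNReal.ofReal (c ^ 2) := by
  rw [← eLpNorm_two_sq, ENNReal.ofReal_pow hc]
  exact (ENNReal.pow_le_pow_left_iff (by norm_num)).symm

lemma integral_sq_le_of_eLpNorm_le {α : Type*} [MeasurableSpace α] {μ : Measure α} {f : α → ℝ}
    {c : ℝ} (hc : 0 ≤ c) (h : eLpNorm f 2 μ ≤ ENNReal.ofReal c) :
    ∫ x, f x ^ 2 ∂μ ≤ c ^ 2 := by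
  by_cases hf : AEStronglyMeasurable (fun x => f x ^ 2) μ
  · rw [integral_eq_lintegral_of_nonneg_ae (ae_of_all _ fun x => sq_nonneg _) hf]
    refine ENNReal.toReal_le_of_le_ofReal (sq_nonneg c) ?_
    refine le_trans (le_of_eq ?_) ((eLpNorm_two_le_ofReal_iff hc).1 h)
    refine lintegral_congr fun x => ?_
    rw [← enorm_pow, Real.enorm_of_nonneg (sq_nonneg _)]
  · rw [integral_undef fun h => hf h.aestronglyMeasurable]
    positivity

lemma centredSum_add {Ω S : Type*} [MeasurableSpace S] {μ : Measure S} {n : ℕ}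
    {ξ : Fin n → Ω → S} {g h : S → ℝ} (hg : Integrable g μ) (hh : Integrable h μ) (ω : Ω) :
    centredSum μ ξ (g + h) ω = centredSum μ ξ g ω + centredSum μ ξ h ω := by
  simp only [centredSum, Pi.add_apply, integral_add hg hh, ← Finset.sum_add_distrib]
  exact Finset.sum_congr rfl fun k _ => by ring

/-- A function squeezed between `0` and `D` has its centred sum controlled by that of `D`, at the
price of the mean of `D`. -/
lemma abs_centredSum_le {Ω S : Type*} [MeasurableSpace S] {μ : Measure S} {n : ℕ}
    {ξ : Fin n → Ω → S} {h D : S → ℝ} (hh : Integrable h μ) (hD : Integrable D μ)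
    (h0 : ∀ s, 0 ≤ h s) (hhD : ∀ s, h s ≤ D s) (ω : Ω) :
    |centredSum μ ξ h ω| ≤ |centredSum μ ξ D ω| + n * ∫ s, D s ∂μ := by
  have hm : ∫ s, h s ∂μ ≤ ∫ s, D s ∂μ := integral_mono hh hD hhD
  have hm0 : 0 ≤ ∫ s, h s ∂μ := integral_nonneg h0
  have e : ∀ g : S → ℝ, centredSum μ ξ g ω = ∑ k, g (ξ k ω) - n * ∫ s, g s ∂μ := fun g => by
    simp [centredSum, Finset.sum_sub_distrib]
  have h1 : ∑ k, h (ξ k ω) ≤ ∑ k, D (ξ k ω) := Finset.sum_le_sum fun k _ => hhD _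
  have h2 : 0 ≤ ∑ k, h (ξ k ω) := Finset.sum_nonneg fun k _ => h0 _
  have h3 : (n : ℝ) * ∫ s, h s ∂μ ≤ n * ∫ s, D s ∂μ := by gcongr
  have h4 : 0 ≤ (n : ℝ) * ∫ s, h s ∂μ := by positivity
  rw [abs_le]
  have h5 := le_abs_self (centredSum μ ξ D ω)
  have h6 := abs_nonneg (centredSum μ ξ D ω)
  rw [e] at h5 h6 ⊢
  rw [e]
  constructor <;> linarith

section

variable {Ω S : Type*} [MeasurableSpace Ω] [MeasurableSpace S] {P : Measure Ω} {μ : Measure S}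
  {n : ℕ} {ξ : Fin n → Ω → S}

lemma IsIIDSample.integral_comp (hξ : IsIIDSample P μ ξ) {g : S → ℝ}
    (hg : AEStronglyMeasurable g μ) (k : Fin n) : ∫ ω, g (ξ k ω) ∂P = ∫ s, g s ∂μ := by
  have := hξ.map_eq k
  subst this
  exact (integral_map (hξ.aemeasurable k) hg).symm

lemma IsIIDSample.memLp_comp (hξ : IsIIDSample P μ ξ) {g : S → ℝ} {p : ℝ≥0∞} (hg : MemLp g p μ)
    (k : Fin n) : MemLp (fun ω => g (ξ k ω)) p P := by
  rw [← hξ.map_eq k] at hg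
  exact hg.comp_of_map (hξ.aemeasurable k)

lemma IsIIDSample.iIndepFun_comp (hξ : IsIIDSample P μ ξ) {g : S → ℝ}
    (hg : AEStronglyMeasurable g μ) : iIndepFun (fun k ω => g (ξ k ω)) P :=
  hξ.indep.comp₀ (fun _ => g) hξ.aemeasurable fun k => by
    rw [hξ.map_eq k]; exact hg.aemeasurable

lemma IsIIDSample.aestronglyMeasurable_centredSum (hξ : IsIIDSample P μ ξ) {g : S → ℝ}
    (hg : AEStronglyMeasurable g μ) : AEStronglyMeasurable (centredSum μ ξ g) P := by
  refine Finset.aestronglyMeasurable_fun_sum _ fun k _ => ?_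
  refine AEStronglyMeasurable.sub ?_ aestronglyMeasurable_const
  rw [← hξ.map_eq k] at hg
  exact hg.comp_aemeasurable (hξ.aemeasurable k)

variable [IsProbabilityMeasure P]

/-- The `L²` norm of a centred sum is at most `√n` times the `L²` norm of the summand. -/
lemma IsIIDSample.eLpNorm_centredSum_le (hξ : IsIIDSample P μ ξ) {g : S → ℝ} (hg : MemLp g 2 μ)
    {s : ℝ} (hs : 0 ≤ s) (hgs : eLpNorm g 2 μ ≤ ENNReal.ofReal s) :
    eLpNorm (centredSum μ ξ g) 2 P ≤ ENNReal.ofReal (√n * s) := by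
  have hX : ∀ k, MemLp (fun ω => g (ξ k ω)) 2 P := hξ.memLp_comp hg
  set X : Fin n → Ω → ℝ := fun k ω => g (ξ k ω)
  have hvar : ∀ k, variance (X k) P ≤ s ^ 2 := fun k => by
    refine (variance_le_expectation_sq (hX k).aestronglyMeasurable).trans ?_
    have : ∫ ω, (X k ω) ^ 2 ∂P = ∫ t, g t ^ 2 ∂μ :=
      hξ.integral_comp (g := fun t => g t ^ 2) (hg.aestronglyMeasurable.pow 2) k
    exact this.le.trans <| integral_sq_le_of_eLpNorm_le hs hgs
  have hsum : variance (∑ k, X k) P ≤ n * s ^ 2 := by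
    rw [IndepFun.variance_sum (fun k _ => hX k) fun i _ j _ hij =>
      (hξ.iIndepFun_comp hg.aestronglyMeasurable).indepFun hij]
    exact (Finset.sum_le_sum fun k _ => hvar k).trans (by simp)
  have hmem : MemLp (∑ k, X k) 2 P := memLp_finsetSum' _ fun k _ => hX k
  rw [eLpNorm_two_le_ofReal_iff (by positivity), mul_pow, Real.sq_sqrt (by positivity)]
  refine le_trans (le_of_eq ?_) (ENNReal.ofReal_le_ofReal hsum)
  rw [hmem.ofReal_variance_eq, evariance]
  refine lintegral_congr fun ω => ?_
  congr 2
  have : ∫ ω, (∑ k, X k) ω ∂P = n * ∫ s, g s ∂μ := by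
    simp only [Finset.sum_apply]
    rw [integral_finsetSum _ fun k _ => (hX k).integrable one_le_two]
    simp [hξ.integral_comp hg.aestronglyMeasurable]
  rw [this]
  simp [centredSum, X]

/-! ### A maximal inequality for finite classes of bounded functions -/

variable [IsProbabilityMeasure μ]

lemma integral_exp_mul_le {g : S → ℝ} (hg : AEStronglyMeasurable g μ) {b s θ : ℝ}
    (hb : ∀ x, |g x| ≤ b) (hs : 0 ≤ s) (hgs : eLpNorm g 2 μ ≤ ENNReal.ofReal s)
    (hθ : |θ| * b ≤ 1) :
    ∫ x, Real.exp (θ * (g x - ∫ y, g y ∂μ)) ∂μ ≤ Real.exp (θ ^ 2 * s ^ 2) := by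
  have hint : Integrable g μ := Integrable.of_bound hg b (ae_of_all _ fun x => hb x)
  have hint2 : Integrable (fun x => g x ^ 2) μ :=
    Integrable.of_bound (hg.pow 2) (b ^ 2) (ae_of_all _ fun x => by
      rw [Real.norm_eq_abs, abs_pow]; exact pow_le_pow_left₀ (abs_nonneg _) (hb x) 2)
  have hsq := integral_sq_le_of_eLpNorm_le hs hgs
  set m := ∫ y, g y ∂μ
  have h1 : ∫ x, Real.exp (θ * g x) ∂μ ≤ 1 + θ * m + θ ^ 2 * s ^ 2 := by
    have hle : ∀ x, Real.exp (θ * g x) ≤ 1 + θ * g x + θ ^ 2 * g x ^ 2 := fun x => by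
      have : |θ * g x| ≤ 1 := by
        rw [abs_mul]
        exact (mul_le_mul_of_nonneg_left (hb x) (abs_nonneg _)).trans hθ
      have := (abs_le.1 (Real.abs_exp_sub_one_sub_id_le this)).2
      nlinarith
    have hi : Integrable (fun x => 1 + θ * g x + θ ^ 2 * g x ^ 2) μ :=
      ((integrable_const _).add (hint.const_mul _)).add (hint2.const_mul _)
    calc ∫ x, Real.exp (θ * g x) ∂μ ≤ ∫ x, (1 + θ * g x + θ ^ 2 * g x ^ 2) ∂μ :=
          integral_mono_of_nonneg (ae_of_all _ fun x => (Real.exp_pos _).le) hi (ae_of_all _ hle)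
      _ = 1 + θ * m + θ ^ 2 * ∫ x, g x ^ 2 ∂μ := by
          rw [integral_add (f := fun x => 1 + θ * g x)
              ((integrable_const _).add (hint.const_mul _)) (hint2.const_mul _),
            integral_add (integrable_const _) (hint.const_mul _), integral_const_mul,
            integral_const_mul]
          simp [m]
      _ ≤ _ := by gcongr
  have h2 : (fun x => Real.exp (θ * (g x - m))) =
      fun x => Real.exp (-(θ * m)) * Real.exp (θ * g x) := by
    funext x; rw [← Real.exp_add]; congr 1; ring
  rw [h2, integral_const_mul]
  calc Real.exp (-(θ * m)) * ∫ x, Real.exp (θ * g x) ∂μ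
      ≤ Real.exp (-(θ * m)) * Real.exp (θ * m + θ ^ 2 * s ^ 2) := by
        gcongr
        exact h1.trans (by linarith [Real.add_one_le_exp (θ * m + θ ^ 2 * s ^ 2)])
    _ = _ := by rw [← Real.exp_add]; congr 1; ring

lemma IsIIDSample.exp_centredSum (hξ : IsIIDSample P μ ξ) {g : S → ℝ}
    (hg : AEStronglyMeasurable g μ) {b s θ : ℝ} (hb : ∀ x, |g x| ≤ b) (hs : 0 ≤ s)
    (hgs : eLpNorm g 2 μ ≤ ENNReal.ofReal s) (hθ : |θ| * b ≤ 1) :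
    Integrable (fun ω => Real.exp (θ * centredSum μ ξ g ω)) P ∧
      ∫ ω, Real.exp (θ * centredSum μ ξ g ω) ∂P ≤ Real.exp (n * (θ ^ 2 * s ^ 2)) := by
  set m := ∫ y, g y ∂μ
  have hg' : AEStronglyMeasurable (fun x => g x - m) μ := hg.sub aestronglyMeasurable_const
  set X : Fin n → Ω → ℝ := fun k ω => g (ξ k ω) - m with hX
  have hXm : ∀ k, AEMeasurable (X k) P := fun k => by
    have : AEMeasurable (fun x => g x - m) (P.map (ξ k)) := by
      rw [hξ.map_eq k]; exact hg'.aemeasurable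
    exact this.comp_aemeasurable (hξ.aemeasurable k)
  have hsum : centredSum μ ξ g = ∑ k, X k := by
    funext ω; simp [centredSum, hX, m]
  constructor
  · refine Integrable.of_bound (C := Real.exp (|θ| * (n * (b + |m|)))) ?_ (ae_of_all _ fun ω => ?_)
    · exact Real.continuous_exp.comp_aestronglyMeasurable
        ((hξ.aestronglyMeasurable_centredSum hg).const_mul θ)
    · rw [Real.norm_eq_abs, Real.abs_exp, Real.exp_le_exp]
      refine (le_abs_self _).trans ?_
      rw [abs_mul]
      gcongr
      refine (Finset.abs_sum_le_sum_abs _ _).trans ?_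
      refine (Finset.sum_le_sum fun k _ =>
        (abs_sub _ _).trans (add_le_add (hb (ξ k ω)) le_rfl)).trans ?_
      simp [m, mul_add]
  · have h1 := (hξ.iIndepFun_comp hg').mgf_sum₀ (t := θ) hXm Finset.univ
    have h2 : ∀ k, mgf (X k) P θ ≤ Real.exp (θ ^ 2 * s ^ 2) := fun k => by
      have := hξ.integral_comp (g := fun x => Real.exp (θ * (g x - m)))
        (Real.continuous_exp.comp_aestronglyMeasurable (hg'.const_mul θ)) k
      rw [mgf]
      exact this.le.trans (integral_exp_mul_le hg hb hs hgs hθ)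
    have h3 : ∫ ω, Real.exp (θ * centredSum μ ξ g ω) ∂P = mgf (∑ k, X k) P θ := by
      rw [hsum]; rfl
    rw [h3]
    refine h1.le.trans ((Finset.prod_le_prod (fun k _ => mgf_nonneg) fun k _ => h2 k).trans ?_)
    rw [Finset.prod_const, Finset.card_univ, Fintype.card_fin, ← Real.exp_nat_mul]

/-- A square is dominated by a constant plus an exponential; this turns bounds on moment generating
functions into `L²` bounds. -/
lemma sq_le_add_exp {y A : ℝ} (hA : 0 ≤ A) :
    y ^ 2 ≤ 2 * A ^ 2 + 4 * (Real.exp (y - A) + Real.exp (-y - A)) := by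
  wlog hy : 0 ≤ y generalizing y
  · have := this (y := -y) (by linarith)
    rw [neg_sq, neg_neg] at this
    linarith
  have h0 := Real.exp_pos (-y - A)
  rcases le_total y A with h | h
  · have := Real.exp_pos (y - A)
    nlinarith
  · have := Real.quadratic_le_exp_of_nonneg (sub_nonneg.2 h)
    nlinarith [sq_nonneg (y - A - A)]

/-- Maximal inequality: the centred sums of at most `exp (l²)` functions that are bounded by `b` and
have `L²` norm at most `r` are dominated by one random variable of `L²` norm at most
`4 (b l² + √n r l)`. -/
lemma IsIIDSample.exists_dominating_of_finite {I : Type*} (hξ : IsIIDSample P μ ξ) (hn : 1 ≤ n)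
    {h : I → S → ℝ} (hfin : (range h).Finite) {l b r : ℝ} (hl : 1 ≤ l) (hb : 0 < b) (hr : 0 < r)
    (hcard : ((range h).ncard : ℝ) ≤ Real.exp (l ^ 2))
    (hmeas : ∀ i, AEStronglyMeasurable (h i) μ) (hbd : ∀ i x, |h i x| ≤ b)
    (hL2 : ∀ i, eLpNorm (h i) 2 μ ≤ ENNReal.ofReal r) :
    ∃ W : Ω → ℝ, AEStronglyMeasurable W P ∧ (∀ i ω, |centredSum μ ξ (h i) ω| ≤ W ω) ∧
      eLpNorm W 2 P ≤ ENNReal.ofReal (4 * (b * l ^ 2 + √n * r * l)) := by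
  classical
  have hn0 : (0 : ℝ) < √n := by positivity
  -- the largest exponent allowed by the bound `b` for which the variance term is at most `l²`
  set θ := min (1 / b) (l / (√n * r)) with hθ
  have hθ0 : 0 < θ := by positivity
  have hθb : |θ| * b ≤ 1 := by
    rw [abs_of_pos hθ0]
    calc θ * b ≤ 1 / b * b := by gcongr; exact min_le_left _ _
      _ = 1 := by field_simp
  have hθb' : |-θ| * b ≤ 1 := by rwa [abs_neg]
  have hθv : n * (θ ^ 2 * r ^ 2) ≤ l ^ 2 := by
    have : √n * θ * r ≤ l := by
      calc √n * θ * r ≤ √n * (l / (√n * r)) * r := by gcongr; exact min_le_right _ _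
        _ = l := by field_simp
    calc n * (θ ^ 2 * r ^ 2) = (√n * θ * r) ^ 2 := by
          rw [mul_pow, mul_pow, Real.sq_sqrt (by positivity)]; ring
      _ ≤ l ^ 2 := by gcongr
  have hθinv : 1 / θ ≤ b + √n * r / l := by
    rcases min_choice (1 / b) (l / (√n * r)) with h | h
    · rw [hθ, h, one_div_one_div]
      have : 0 ≤ √n * r / l := by positivity
      linarith
    · rw [hθ, h, one_div_div]
      linarith
  set T := hfin.toFinset
  set A := 2 * l ^ 2 with hA
  have hAnn : 0 ≤ A := by positivity
  set V : Ω → ℝ := fun ω => 2 * A ^ 2 + 4 * ∑ g ∈ T,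
    (Real.exp (θ * centredSum μ ξ g ω - A) + Real.exp (-(θ * centredSum μ ξ g ω) - A)) with hV
  have hT : ∀ g ∈ T, ∃ i, h i = g := fun g hg => by simpa [T] using hg
  have hV0 : ∀ ω, 0 ≤ V ω := fun ω => by
    have : ∀ g ∈ T, 0 ≤
      (Real.exp (θ * centredSum μ ξ g ω - A) + Real.exp (-(θ * centredSum μ ξ g ω) - A)) :=
      fun g _ => by positivity
    have := Finset.sum_nonneg this
    positivity
  have hterm : ∀ g ∈ T, Integrable (fun ω => Real.exp (θ * centredSum μ ξ g ω - A) +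
      Real.exp (-(θ * centredSum μ ξ g ω) - A)) P ∧
      ∫ ω, (Real.exp (θ * centredSum μ ξ g ω - A) +
        Real.exp (-(θ * centredSum μ ξ g ω) - A)) ∂P ≤ 2 * Real.exp (-l ^ 2) := by
    intro g hg
    obtain ⟨i, rfl⟩ := hT g hg
    obtain ⟨i1, b1⟩ := hξ.exp_centredSum (hmeas i) (hbd i) hr.le (hL2 i) hθb
    obtain ⟨i2, b2⟩ := hξ.exp_centredSum (hmeas i) (hbd i) hr.le (hL2 i) hθb'
    have e : (fun ω => Real.exp (θ * centredSum μ ξ (h i) ω - A) +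
        Real.exp (-(θ * centredSum μ ξ (h i) ω) - A)) = fun ω =>
        Real.exp (-A) * Real.exp (θ * centredSum μ ξ (h i) ω) +
        Real.exp (-A) * Real.exp (-θ * centredSum μ ξ (h i) ω) := by
      funext ω
      rw [← Real.exp_add, ← Real.exp_add]
      congr 2 <;> ring
    rw [e]
    refine ⟨(i1.const_mul _).add (i2.const_mul _), ?_⟩
    rw [integral_add (i1.const_mul _) (i2.const_mul _), integral_const_mul, integral_const_mul]
    rw [neg_sq] at b2
    have hexp : Real.exp (n * (θ ^ 2 * r ^ 2)) ≤ Real.exp (l ^ 2) := Real.exp_le_exp.2 hθv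
    calc _ ≤ Real.exp (-A) * Real.exp (l ^ 2) + Real.exp (-A) * Real.exp (l ^ 2) := by
          gcongr
          · exact b1.trans hexp
          · exact b2.trans hexp
      _ = 2 * Real.exp (-l ^ 2) := by
          rw [← Real.exp_add, hA, show -(2 * l ^ 2) + l ^ 2 = -l ^ 2 by ring]; ring
  have hVint : Integrable V P :=
    (integrable_const _).add ((integrable_finsetSum _ fun g hg => (hterm g hg).1).const_mul _)
  have hVle : ∫ ω, V ω ∂P ≤ 16 * l ^ 4 := by
    have e1 : ∫ ω, V ω ∂P = 2 * A ^ 2 + 4 * ∑ g ∈ T, ∫ ω,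
        (Real.exp (θ * centredSum μ ξ g ω - A) + Real.exp (-(θ * centredSum μ ξ g ω) - A)) ∂P := by
      rw [integral_add (f := fun _ => 2 * A ^ 2) (integrable_const _)
        ((integrable_finsetSum _ fun g hg => (hterm g hg).1).const_mul _), integral_const_mul 4,
        integral_finsetSum T fun g hg => (hterm g hg).1]
      simp
    have hc : (T.card : ℝ) ≤ Real.exp (l ^ 2) := by
      rwa [← Set.ncard_eq_toFinset_card _ hfin]
    have e2 : ∑ g ∈ T, ∫ ω, (Real.exp (θ * centredSum μ ξ g ω - A) +
        Real.exp (-(θ * centredSum μ ξ g ω) - A)) ∂P ≤ 2 := by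
      refine (Finset.sum_le_sum fun g hg => (hterm g hg).2).trans ?_
      rw [Finset.sum_const, nsmul_eq_mul]
      calc (T.card : ℝ) * (2 * Real.exp (-l ^ 2))
          ≤ Real.exp (l ^ 2) * (2 * Real.exp (-l ^ 2)) := by gcongr
        _ = 2 := by rw [mul_left_comm, ← Real.exp_add]; simp
    have hl4 : 1 ≤ l ^ 4 := one_le_pow₀ hl
    rw [e1, hA]
    nlinarith
  refine ⟨fun ω => √(V ω) / θ, ?_, fun i ω => ?_, ?_⟩
  · exact ((Real.continuous_sqrt.div_const θ).comp_aestronglyMeasurable hVint.aestronglyMeasurable)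
  · rw [le_div_iff₀ hθ0]
    refine Real.le_sqrt_of_sq_le ?_
    rw [mul_pow, sq_abs, ← mul_pow, mul_comm]
    refine (sq_le_add_exp hAnn).trans ?_
    simp only [hV]
    gcongr
    exact Finset.single_le_sum (f := fun g => Real.exp (θ * centredSum μ ξ g ω - A) +
      Real.exp (-(θ * centredSum μ ξ g ω) - A)) (fun g _ => by positivity)
      (by simp [T] : h i ∈ T)
  · have hmain : eLpNorm (fun ω => √(V ω) / θ) 2 P ≤ ENNReal.ofReal (4 * l ^ 2 * (1 / θ)) := by
      rw [eLpNorm_two_le_ofReal_iff (by positivity)]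
      have : ∀ ω, ‖√(V ω) / θ‖ₑ ^ 2 = ENNReal.ofReal (V ω / θ ^ 2) := fun ω => by
        rw [← enorm_pow, Real.enorm_of_nonneg (sq_nonneg _), div_pow, Real.sq_sqrt (hV0 ω)]
      simp_rw [this]
      rw [← ofReal_integral_eq_lintegral_ofReal (hVint.div_const _)
        (ae_of_all _ fun ω => div_nonneg (hV0 ω) (sq_nonneg _)), integral_div]
      refine ENNReal.ofReal_le_ofReal ?_
      rw [div_eq_mul_one_div]
      calc (∫ ω, V ω ∂P) * (1 / θ ^ 2) ≤ 16 * l ^ 4 * (1 / θ ^ 2) := by gcongr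
        _ = _ := by ring
    refine hmain.trans (ENNReal.ofReal_le_ofReal ?_)
    calc 4 * l ^ 2 * (1 / θ) ≤ 4 * l ^ 2 * (b + √n * r / l) := by gcongr
      _ = 4 * (b * l ^ 2 + √n * r * l) := by field_simp

end

/-! ### Bracketing chains -/

/-- The data of a bracketing chain for the class `{g i}` in `L²(μ)`: an envelope `F` of norm at most
`a`, and for each level `p` a choice `β p i` of a bracket of width less than `a / 2 ^ (p + 1)` around
`g i`, with at most `exp (q p ^ 2)` different brackets. -/
structure IsBracketChain {I S : Type*} [MeasurableSpace S] (μ : Measure S) (g : I → S → ℝ)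
    (F : S → ℝ) (a : ℝ) (β : ℕ → I → (S → ℝ) × (S → ℝ)) (q : ℕ → ℝ) : Prop where
  pos : 0 < a
  memLp : MemLp F 2 μ
  eLpNorm_le : eLpNorm F 2 μ ≤ ENNReal.ofReal a
  abs_le : ∀ i s, |g i s| ≤ F s
  meas : ∀ i, AEStronglyMeasurable (g i) μ
  bracket : ∀ p i, IsL2Bracket μ (ENNReal.ofReal (a / 2 ^ (p + 1))) (β p i)
  mem : ∀ p i s, (β p i).1 s ≤ g i s ∧ g i s ≤ (β p i).2 s
  one_le : ∀ p, 1 ≤ q p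
  finite : ∀ p, (range (β p)).Finite
  ncard_le : ∀ p, ((range (β p)).ncard : ℝ) ≤ Real.exp (q p ^ 2)

/-- The pair of the intersection `[l, u]` of the brackets chosen at the levels below `p`, starting
from the bracket `[-F, F]` of the envelope, and of the set of points at which, at each level below
`p`, the width of the intersection is at most the threshold `t`. -/
def chainState {I S : Type*} (F : S → ℝ) (β : ℕ → I → (S → ℝ) × (S → ℝ)) (t : ℕ → ℝ) :
    ℕ → I → ((S → ℝ) × (S → ℝ)) × Set S
  | 0, _ => ((-F, F), univ)
  | p + 1, i =>
    (((chainState F β t p i).1.1 ⊔ (β p i).1, (chainState F β t p i).1.2 ⊓ (β p i).2),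
      (chainState F β t p i).2 ∩
        {s | ((chainState F β t p i).1.2 - (chainState F β t p i).1.1) s ≤ t p})

/-- The width at level `p` of a chain: a bound for the `L²` norm of the intersected bracket. -/
noncomputable def chainWidth (a : ℝ) (p : ℕ) : ℝ := 2 * a / 2 ^ p

/-- The square of `chainWeight q p` bounds the logarithm of the number of states at level `p`. -/
noncomputable def chainWeight (q : ℕ → ℝ) (p : ℕ) : ℝ := 1 + ∑ r ∈ Finset.range p, q r

/-- The truncation threshold at level `p` for a sample of size `n`. It balances the two terms of the
maximal inequality, `b l²` and `√n r l`. -/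
noncomputable def chainThreshold (a : ℝ) (q : ℕ → ℝ) (n p : ℕ) : ℝ :=
  √n * chainWidth a p / chainWeight q (p + 1)

lemma chainWidth_pos {a : ℝ} (ha : 0 < a) (p : ℕ) : 0 < chainWidth a p := by
  unfold chainWidth; positivity

lemma chainWidth_eq_two_mul_succ (a : ℝ) (p : ℕ) : chainWidth a p = 2 * chainWidth a (p + 1) := by
  unfold chainWidth; rw [pow_succ]; field_simp

lemma finite_range_map₂ {I A B C : Type*} {f : I → A} {g : I → B} (φ : A → B → C)
    (hf : (range f).Finite) (hg : (range g).Finite) :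
    (range fun i => φ (f i) (g i)).Finite ∧
      (range fun i => φ (f i) (g i)).ncard ≤ (range f).ncard * (range g).ncard := by
  have hsub : (range fun i => φ (f i) (g i)) ⊆ (fun p : A × B => φ p.1 p.2) '' (range f ×ˢ range g) := by
    rintro _ ⟨i, rfl⟩
    exact ⟨(f i, g i), ⟨⟨i, rfl⟩, ⟨i, rfl⟩⟩, rfl⟩
  have hfin := hf.prod hg
  refine ⟨(hfin.image _).subset hsub, (ncard_le_ncard hsub (hfin.image _)).trans ?_⟩
  exact (ncard_image_le hfin).trans (ncard_prod).le

lemma eLpNorm_fun_abs {α : Type*} [MeasurableSpace α] {P : Measure α} (f : α → ℝ) (p : ℝ≥0∞) :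
    eLpNorm (fun x => |f x|) p P = eLpNorm f p P :=
  eLpNorm_congr_norm_ae (ae_of_all _ fun x => by simp)

lemma eLpNorm_add_le_ofReal {α : Type*} [MeasurableSpace α] {P : Measure α} {V W : α → ℝ} {a b : ℝ}
    (hV : AEStronglyMeasurable V P) (hW : AEStronglyMeasurable W P) (ha : 0 ≤ a) (hb : 0 ≤ b)
    (h1 : eLpNorm V 2 P ≤ ENNReal.ofReal a) (h2 : eLpNorm W 2 P ≤ ENNReal.ofReal b) :
    eLpNorm (V + W) 2 P ≤ ENNReal.ofReal (a + b) := by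
  rw [ENNReal.ofReal_add ha hb]
  exact (eLpNorm_add_le hV hW one_le_two).trans (add_le_add h1 h2)

lemma chainState_gap_le_threshold_of_mem {I S : Type*} {F : S → ℝ}
    {β : ℕ → I → (S → ℝ) × (S → ℝ)} {t : ℕ → ℝ} {p : ℕ} {i : I} {s : S} (hs : s ∈ (chainState F β t (p + 1) i).2) :
    ((chainState F β t p i).1.2 - (chainState F β t p i).1.1) s ≤ t p := hs.2

lemma chainState_gap_succ_le {I S : Type*} {F : S → ℝ}
    {β : ℕ → I → (S → ℝ) × (S → ℝ)} {t : ℕ → ℝ} (p : ℕ) (i : I) (s : S) :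
    ((chainState F β t (p + 1) i).1.2 - (chainState F β t (p + 1) i).1.1) s ≤
      ((chainState F β t p i).1.2 - (chainState F β t p i).1.1) s :=
  sub_le_sub inf_le_left le_sup_left

lemma chainState_zero {I S : Type*} (F : S → ℝ) (β : ℕ → I → (S → ℝ) × (S → ℝ)) (t : ℕ → ℝ) (i : I) :
    chainState F β t 0 i = ((-F, F), univ) := rfl

namespace IsBracketChain

variable {I S : Type*} [MeasurableSpace S] {μ : Measure S} {g : I → S → ℝ} {F : S → ℝ} {a : ℝ}
  {β : ℕ → I → (S → ℝ) × (S → ℝ)} {q : ℕ → ℝ} {t : ℕ → ℝ}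

lemma one_le_weight (H : IsBracketChain μ g F a β q) (p : ℕ) : 1 ≤ chainWeight q p := by
  have : 0 ≤ ∑ r ∈ Finset.range p, q r :=
    Finset.sum_nonneg fun r _ => zero_le_one.trans (H.one_le r)
  unfold chainWeight; linarith

lemma weight_le_succ (H : IsBracketChain μ g F a β q) (p : ℕ) :
    chainWeight q p ≤ chainWeight q (p + 1) := by
  have := H.one_le p
  unfold chainWeight
  rw [Finset.sum_range_succ]; linarith

lemma threshold_pos (H : IsBracketChain μ g F a β q) {n : ℕ} (hn : 1 ≤ n) (p : ℕ) :
    0 < chainThreshold a q n p := by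
  have h1 := chainWidth_pos H.pos p
  have h2 := H.one_le_weight (p + 1)
  have : (0 : ℝ) < n := by exact_mod_cast hn
  unfold chainThreshold; positivity

lemma mul_width_mul_weight_nonneg (H : IsBracketChain μ g F a β q) (n p : ℕ) :
    0 ≤ √n * chainWidth a p * chainWeight q (p + 1) := by
  have h1 := chainWidth_pos H.pos p
  have h2 := H.one_le_weight (p + 1)
  positivity

lemma weight_sq_add_le (H : IsBracketChain μ g F a β q) (p : ℕ) :
    chainWeight q p ^ 2 + q p ^ 2 ≤ chainWeight q (p + 1) ^ 2 := by
  have h1 := H.one_le p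
  have h2 := H.one_le_weight p
  have : chainWeight q (p + 1) = chainWeight q p + q p := by
    unfold chainWeight; rw [Finset.sum_range_succ]; ring
  rw [this]; nlinarith

lemma finite_state (H : IsBracketChain μ g F a β q) (t : ℕ → ℝ) (p : ℕ) :
    (range (chainState F β t p)).Finite ∧
      ((range (chainState F β t p)).ncard : ℝ) ≤ Real.exp (chainWeight q p ^ 2) := by
  induction p with
  | zero =>
    have hsub : range (chainState F β t 0) ⊆ {((-F, F), univ)} := by
      rintro _ ⟨i, rfl⟩; rfl
    refine ⟨(finite_singleton _).subset hsub, ?_⟩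
    have h1 := ncard_le_ncard hsub (finite_singleton _)
    rw [ncard_singleton] at h1
    have h2 : (1 : ℝ) ≤ Real.exp (chainWeight q 0 ^ 2) := Real.one_le_exp (sq_nonneg _)
    exact le_trans (by exact_mod_cast h1) h2
  | succ p ih =>
    obtain ⟨h1, h2⟩ := finite_range_map₂ (fun (σ : ((S → ℝ) × (S → ℝ)) × Set S)
      (b : (S → ℝ) × (S → ℝ)) => ((σ.1.1 ⊔ b.1, σ.1.2 ⊓ b.2), σ.2 ∩ {s | (σ.1.2 - σ.1.1) s ≤ t p}))
      ih.1 (H.finite p)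
    refine ⟨h1, ?_⟩
    calc ((range (chainState F β t (p + 1))).ncard : ℝ)
        ≤ (range (chainState F β t p)).ncard * (range (β p)).ncard := by exact_mod_cast h2
      _ ≤ Real.exp (chainWeight q p ^ 2) * Real.exp (q p ^ 2) :=
          mul_le_mul ih.2 (H.ncard_le p) (Nat.cast_nonneg _) (Real.exp_pos _).le
      _ ≤ _ := by rw [← Real.exp_add]; exact Real.exp_le_exp.2 (H.weight_sq_add_le p)

lemma state_mem (H : IsBracketChain μ g F a β q) (p : ℕ) (i : I) (s : S) :
    (chainState F β t p i).1.1 s ≤ g i s ∧ g i s ≤ (chainState F β t p i).1.2 s := by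
  induction p with
  | zero => exact _root_.abs_le.1 (H.abs_le i s)
  | succ p ih => exact ⟨sup_le ih.1 (H.mem p i s).1, le_inf ih.2 (H.mem p i s).2⟩

lemma memLp_class (H : IsBracketChain μ g F a β q) (i : I) : MemLp (g i) 2 μ :=
  H.memLp.mono' (H.meas i) (ae_of_all _ (H.abs_le i))

lemma memLp_state (H : IsBracketChain μ g F a β q) (p : ℕ) (i : I) :
    MemLp (chainState F β t p i).1.1 2 μ ∧ MemLp (chainState F β t p i).1.2 2 μ := by
  induction p with
  | zero => exact ⟨H.memLp.neg, H.memLp⟩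
  | succ p ih => exact ⟨ih.1.sup (H.bracket p i).1, ih.2.inf (H.bracket p i).2.1⟩

lemma memLp_gap (H : IsBracketChain μ g F a β q) (p : ℕ) (i : I) :
    MemLp ((chainState F β t p i).1.2 - (chainState F β t p i).1.1) 2 μ :=
  (H.memLp_state p i).2.sub (H.memLp_state p i).1

lemma nullMeasurableSet_gap_le (H : IsBracketChain μ g F a β q) (p : ℕ) (i : I) (c : ℝ) :
    NullMeasurableSet
      {s | ((chainState F β t p i).1.2 - (chainState F β t p i).1.1) s ≤ c} μ :=
  nullMeasurableSet_le (H.memLp_gap p i).aestronglyMeasurable.aemeasurable aemeasurable_const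

lemma nullMeasurableSet_state (H : IsBracketChain μ g F a β q) (p : ℕ) (i : I) :
    NullMeasurableSet (chainState F β t p i).2 μ := by
  induction p with
  | zero => exact nullMeasurableSet_univ
  | succ p ih => exact ih.inter (H.nullMeasurableSet_gap_le p i _)

lemma gap_nonneg (H : IsBracketChain μ g F a β q) (p : ℕ) (i : I) (s : S) :
    0 ≤ ((chainState F β t p i).1.2 - (chainState F β t p i).1.1) s :=
  sub_nonneg.2 ((H.state_mem p i s).1.trans (H.state_mem p i s).2)

lemma eLpNorm_gap_le (H : IsBracketChain μ g F a β q) (p : ℕ) (i : I) :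
    eLpNorm ((chainState F β t p i).1.2 - (chainState F β t p i).1.1) 2 μ ≤
      ENNReal.ofReal (chainWidth a p) := by
  have ha := H.pos
  cases p with
  | zero =>
    have : chainWidth a 0 = a + a := by unfold chainWidth; ring
    rw [this]
    show eLpNorm (F - -F) 2 μ ≤ _
    rw [sub_neg_eq_add]
    exact eLpNorm_add_le_ofReal H.memLp.aestronglyMeasurable H.memLp.aestronglyMeasurable
      ha.le ha.le H.eLpNorm_le H.eLpNorm_le
  | succ p =>
    have h1 : eLpNorm ((β p i).2 - (β p i).1) 2 μ ≤ ENNReal.ofReal (chainWidth a (p + 1)) := by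
      refine (H.bracket p i).2.2.le.trans (ENNReal.ofReal_le_ofReal ?_)
      unfold chainWidth; gcongr; linarith
    refine le_trans (eLpNorm_mono_real fun s => ?_) h1
    rw [Real.norm_eq_abs, abs_of_nonneg (H.gap_nonneg (p + 1) i s)]
    exact sub_le_sub inf_le_right le_sup_right

/-- The mean of the width on the set where it exceeds the threshold, bounded by Markov's
inequality. -/
lemma mul_integral_gap_le (H : IsBracketChain μ g F a β q) {n : ℕ} (hn : 1 ≤ n) (p : ℕ) (i : I) {C : Set S}
    (hC : ∀ s ∈ C, chainThreshold a q n p ≤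
      ((chainState F β t p i).1.2 - (chainState F β t p i).1.1) s) :
    n * ∫ s, C.indicator ((chainState F β t p i).1.2 - (chainState F β t p i).1.1) s ∂μ ≤
      √n * chainWidth a p * chainWeight q (p + 1) := by
  have ht := H.threshold_pos hn p
  have hw := chainWidth_pos H.pos p
  have hl := H.one_le_weight (p + 1)
  have hn0 : (0 : ℝ) < √n := by positivity
  set D := (chainState F β t p i).1.2 - (chainState F β t p i).1.1
  have hD := integral_sq_le_of_eLpNorm_le hw.le (H.eLpNorm_gap_le (t := t) p i)
  have h1 : ∫ s, C.indicator D s ∂μ ≤ ∫ s, D s ^ 2 / chainThreshold a q n p ∂μ := by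
    refine integral_mono_of_nonneg (ae_of_all _ fun s => ?_)
      ((H.memLp_gap p i).integrable_sq.div_const _) (ae_of_all _ fun s => ?_)
    · exact indicator_nonneg (fun s _ => H.gap_nonneg p i s) s
    · simp only [indicator]
      split_ifs with hs
      · rw [le_div_iff₀ ht, sq]
        exact mul_le_mul_of_nonneg_left (hC s hs) (H.gap_nonneg p i s)
      · positivity
  rw [integral_div] at h1
  calc n * ∫ s, C.indicator D s ∂μ ≤ n * (chainWidth a p ^ 2 / chainThreshold a q n p) := by
        gcongr
        exact h1.trans (by gcongr)
    _ = √n * √n * (chainWidth a p ^ 2 / chainThreshold a q n p) := by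
        rw [Real.mul_self_sqrt (Nat.cast_nonneg n)]
    _ = _ := by unfold chainThreshold; field_simp

/-! ### Chaining with adaptive truncation -/

variable {Ω : Type*} [MeasurableSpace Ω] {P : Measure Ω} {n : ℕ} {ξ : Fin n → Ω → S}
  [IsProbabilityMeasure P] [IsProbabilityMeasure μ]

/-- The truncated widths of a chain. The set `κ σ` is a part of the truncation set of the state `σ`,
on which the width of the preceding level is below its threshold. -/
lemma exists_dominating_gap [Nonempty I] (H : IsBracketChain μ g F a β q)
    (hξ : IsIIDSample P μ ξ) (hn : 1 ≤ n) (p : ℕ) (κ : ((S → ℝ) × (S → ℝ)) × Set S → Set S)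
    (hκ : ∀ i, NullMeasurableSet (κ (chainState F β (chainThreshold a q n) p i)) μ)
    (hsub : ∀ i, κ (chainState F β (chainThreshold a q n) p i) ⊆
      (chainState F β (chainThreshold a q n) p i).2) :
    ∃ V : Ω → ℝ, AEStronglyMeasurable V P ∧
      (∀ i ω, |centredSum μ ξ ((κ (chainState F β (chainThreshold a q n) p i)).indicator
        ((chainState F β (chainThreshold a q n) p i).1.2 -
          (chainState F β (chainThreshold a q n) p i).1.1)) ω| ≤ V ω) ∧
      eLpNorm V 2 P ≤ ENNReal.ofReal (16 * (√n * chainWidth a p * chainWeight q (p + 1))) := by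
  set t := chainThreshold a q n
  have hn0 : (0 : ℝ) < √n := by positivity
  set h : I → S → ℝ := fun i => (κ (chainState F β t p i)).indicator
    ((chainState F β t p i).1.2 - (chainState F β t p i).1.1) with hh
  have hmeas : ∀ i, AEStronglyMeasurable (h i) μ := fun i =>
    (H.memLp_gap p i).aestronglyMeasurable.indicator₀ (hκ i)
  have hnorm : ∀ i, eLpNorm (h i) 2 μ ≤ ENNReal.ofReal (chainWidth a p) := fun i =>
    (eLpNorm_indicator_le _).trans (H.eLpNorm_gap_le p i)
  have hw := chainWidth_pos H.pos p
  cases p with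
  | zero =>
    let i₀ : I := Classical.arbitrary I
    have hconst : ∀ i, h i = h i₀ := fun i => by simp only [hh, chainState_zero]
    refine ⟨fun ω => |centredSum μ ξ (h i₀) ω|,
      (hξ.aestronglyMeasurable_centredSum (hmeas i₀)).norm, fun i ω => ?_, ?_⟩
    · change |centredSum μ ξ (h i) ω| ≤ _
      rw [hconst i]
    · rw [eLpNorm_fun_abs]
      refine (hξ.eLpNorm_centredSum_le ⟨hmeas i₀, (hnorm i₀).trans_lt ENNReal.ofReal_lt_top⟩ hw.le
        (hnorm i₀)).trans (ENNReal.ofReal_le_ofReal ?_)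
      have h2 := H.one_le_weight 1
      have h3 : 0 < √n * chainWidth a 0 := by positivity
      nlinarith
  | succ p =>
    have hl := H.one_le_weight (p + 1)
    have hwp := chainWidth_pos H.pos p
    obtain ⟨hfin, hcard⟩ := H.finite_state t (p + 1)
    have hfactor : range h = (fun σ : ((S → ℝ) × (S → ℝ)) × Set S =>
        (κ σ).indicator (σ.1.2 - σ.1.1)) '' range (chainState F β t (p + 1)) := by
      rw [← range_comp]; rfl
    obtain ⟨V, hV1, hV2, hV3⟩ := hξ.exists_dominating_of_finite hn (h := h)
      (by rw [hfactor]; exact hfin.image _) hl (H.threshold_pos hn p) hwp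
      (by rw [hfactor]; exact le_trans (by exact_mod_cast ncard_image_le hfin) hcard) hmeas
      (fun i s => by
        simp only [hh, indicator]
        split_ifs with hs
        · rw [abs_of_nonneg (H.gap_nonneg _ i s)]
          exact (chainState_gap_succ_le p i s).trans (chainState_gap_le_threshold_of_mem (hsub i hs))
        · rw [abs_zero]; exact (H.threshold_pos hn p).le)
      (fun i => (hnorm i).trans (ENNReal.ofReal_le_ofReal (by
        rw [chainWidth_eq_two_mul_succ a p]; linarith)))
    refine ⟨V, hV1, hV2, hV3.trans (ENNReal.ofReal_le_ofReal ?_)⟩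
    have e : chainThreshold a q n p * chainWeight q (p + 1) ^ 2 =
        √n * chainWidth a p * chainWeight q (p + 1) := by
      unfold chainThreshold; field_simp
    rw [e, chainWidth_eq_two_mul_succ a p]
    have : √n * chainWidth a (p + 1) * chainWeight q (p + 1) ≤
        √n * chainWidth a (p + 1) * chainWeight q (p + 1 + 1) := by
      gcongr
      exact H.weight_le_succ (p + 1)
    linarith

/-- The truncated links `l (p + 1) - l p` of a chain. -/
lemma exists_dominating_link (H : IsBracketChain μ g F a β q)
    (hξ : IsIIDSample P μ ξ) (hn : 1 ≤ n) (p : ℕ) :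
    ∃ V : Ω → ℝ, AEStronglyMeasurable V P ∧
      (∀ i ω, |centredSum μ ξ ((chainState F β (chainThreshold a q n) (p + 1) i).2.indicator
        ((chainState F β (chainThreshold a q n) (p + 1) i).1.1 -
          (chainState F β (chainThreshold a q n) p i).1.1)) ω| ≤ V ω) ∧
      eLpNorm V 2 P ≤ ENNReal.ofReal (8 * (√n * chainWidth a p * chainWeight q (p + 1))) := by
  set t := chainThreshold a q n
  set h : I → S → ℝ := fun i => (chainState F β t (p + 1) i).2.indicator
    ((chainState F β t (p + 1) i).1.1 - (chainState F β t p i).1.1) with hh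
  have hmeas : ∀ i, AEStronglyMeasurable (h i) μ := fun i =>
    ((H.memLp_state (p + 1) i).1.sub (H.memLp_state p i).1).aestronglyMeasurable.indicator₀
      (H.nullMeasurableSet_state (p + 1) i)
  have hw := chainWidth_pos H.pos p
  have hl := H.one_le_weight (p + 1)
  have habs : ∀ i s, |((chainState F β t (p + 1) i).1.1 - (chainState F β t p i).1.1) s| ≤
      ((chainState F β t p i).1.2 - (chainState F β t p i).1.1) s := fun i s => by
    have h1 : (chainState F β t p i).1.1 s ≤ (chainState F β t (p + 1) i).1.1 s := le_sup_left
    have h2 := (H.state_mem (t := t) (p + 1) i s).1.trans (H.state_mem (t := t) p i s).2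
    simp only [Pi.sub_apply]
    rw [abs_of_nonneg (sub_nonneg.2 h1)]
    linarith
  have hnorm : ∀ i, eLpNorm (h i) 2 μ ≤ ENNReal.ofReal (chainWidth a p) := fun i =>
    (eLpNorm_indicator_le _).trans ((eLpNorm_mono_real fun s => habs i s).trans
      (H.eLpNorm_gap_le p i))
  obtain ⟨hfin, hcard⟩ := H.finite_state t p
  obtain ⟨hfin', hcard'⟩ := finite_range_map₂ (fun (σ : ((S → ℝ) × (S → ℝ)) × Set S)
      (b : (S → ℝ) × (S → ℝ)) => (σ.2 ∩ {s | (σ.1.2 - σ.1.1) s ≤ t p}).indicator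
        (σ.1.1 ⊔ b.1 - σ.1.1)) hfin (H.finite p)
  obtain ⟨V, hV1, hV2, hV3⟩ := hξ.exists_dominating_of_finite hn (h := h)
    hfin' hl (H.threshold_pos hn p) hw
    (by
      calc ((range h).ncard : ℝ)
          ≤ (range (chainState F β t p)).ncard * (range (β p)).ncard := by exact_mod_cast hcard'
        _ ≤ Real.exp (chainWeight q p ^ 2) * Real.exp (q p ^ 2) :=
            mul_le_mul hcard (H.ncard_le p) (Nat.cast_nonneg _) (Real.exp_pos _).le
        _ ≤ _ := by rw [← Real.exp_add]; exact Real.exp_le_exp.2 (H.weight_sq_add_le p))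
    hmeas
    (fun i s => by
      simp only [hh, indicator]
      split_ifs with hs
      · exact (habs i s).trans (chainState_gap_le_threshold_of_mem hs)
      · rw [abs_zero]; exact (H.threshold_pos hn p).le)
    hnorm
  refine ⟨V, hV1, hV2, hV3.trans (ENNReal.ofReal_le_ofReal ?_)⟩
  have e : chainThreshold a q n p * chainWeight q (p + 1) ^ 2 =
      √n * chainWidth a p * chainWeight q (p + 1) := by
    unfold chainThreshold; field_simp
  rw [e]
  linarith

/-- The chaining decomposition: the centred sums of the class are dominated by the first `M` links
and truncated widths, up to what remains of `g i - l M` on the `M`-th truncation set. -/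
lemma exists_dominating_links [Nonempty I] (H : IsBracketChain μ g F a β q)
    (hξ : IsIIDSample P μ ξ) (hn : 1 ≤ n) (M : ℕ) :
    ∃ W : Ω → ℝ, AEStronglyMeasurable W P ∧
      (∀ i ω, |centredSum μ ξ (g i) ω| ≤ W ω +
        |centredSum μ ξ ((chainState F β (chainThreshold a q n) M i).2.indicator
          (g i - (chainState F β (chainThreshold a q n) M i).1.1)) ω|) ∧
      eLpNorm W 2 P ≤ ENNReal.ofReal (√n * a +
        25 * ∑ p ∈ Finset.range M, √n * chainWidth a p * chainWeight q (p + 1)) := by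
  set t := chainThreshold a q n
  have hg : ∀ i, MemLp (g i) 2 μ := H.memLp_class
  have hterm : ∀ p, 0 ≤ √n * chainWidth a p * chainWeight q (p + 1) :=
    H.mul_width_mul_weight_nonneg n
  induction M with
  | zero =>
    refine ⟨fun ω => |centredSum μ ξ (-F) ω|,
      (hξ.aestronglyMeasurable_centredSum H.memLp.aestronglyMeasurable.neg).norm, fun i ω => ?_, ?_⟩
    · have e : g i = -F + (chainState F β t 0 i).2.indicator
          (g i - (chainState F β t 0 i).1.1) := by
        rw [chainState_zero]; simp
      conv_lhs => rw [e]
      rw [centredSum_add (H.memLp.neg.integrable one_le_two)]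
      · exact abs_add_le _ _
      · rw [chainState_zero]
        simpa using
          ((hg i).integrable one_le_two).add (H.memLp.integrable one_le_two)
    · rw [eLpNorm_fun_abs]
      refine (hξ.eLpNorm_centredSum_le H.memLp.neg H.pos.le ?_).trans (by simp)
      rw [eLpNorm_neg]; exact H.eLpNorm_le
  | succ M ih =>
    obtain ⟨W, hW1, hW2, hW3⟩ := ih
    obtain ⟨V, hV1, hV2, hV3⟩ := H.exists_dominating_link hξ hn M
    set κ : ((S → ℝ) × (S → ℝ)) × Set S → Set S := fun σ => σ.2 \ {s | (σ.1.2 - σ.1.1) s ≤ t M}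
    have hκm : ∀ i, NullMeasurableSet (κ (chainState F β t M i)) μ := fun i =>
      (H.nullMeasurableSet_state M i).diff (H.nullMeasurableSet_gap_le M i _)
    obtain ⟨U, hU1, hU2, hU3⟩ := H.exists_dominating_gap hξ hn M κ hκm fun i => sdiff_subset
    set c := √n * chainWidth a M * chainWeight q (M + 1) with hc
    have hc0 : 0 ≤ c := hterm M
    refine ⟨W + (V + (U + fun _ => c)), hW1.add (hV1.add (hU1.add aestronglyMeasurable_const)),
      fun i ω => ?_, ?_⟩
    · set l := (chainState F β t M i).1.1
      set l' := (chainState F β t (M + 1) i).1.1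
      set D := (chainState F β t M i).1.2 - l
      set B := (chainState F β t M i).2
      set B' := (chainState F β t (M + 1) i).2
      set C := κ (chainState F β t M i)
      have hl : MemLp l 2 μ := (H.memLp_state M i).1
      have hl' : MemLp l' 2 μ := (H.memLp_state (M + 1) i).1
      have hBm' : NullMeasurableSet B' μ := H.nullMeasurableSet_state (M + 1) i
      have e : B.indicator (g i - l) =
          B'.indicator (l' - l) + (C.indicator (g i - l) + B'.indicator (g i - l')) := by
        funext s
        simp only [Pi.add_apply, indicator, Pi.sub_apply]
        have hB : s ∈ B' ↔ s ∈ B ∧ D s ≤ t M := Iff.rfl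
        have hCs : s ∈ C ↔ s ∈ B ∧ ¬ D s ≤ t M := Iff.rfl
        by_cases h1 : s ∈ B <;> by_cases h2 : D s ≤ t M <;> simp [hB, hCs, h1, h2]
      have i1 : Integrable (B'.indicator (l' - l)) μ :=
        ((hl'.sub hl).integrable one_le_two).indicator₀ hBm'
      have i2 : Integrable (C.indicator (g i - l)) μ :=
        (((hg i).sub hl).integrable one_le_two).indicator₀ (hκm i)
      have i3 : Integrable (B'.indicator (g i - l')) μ :=
        (((hg i).sub hl').integrable one_le_two).indicator₀ hBm'
      have i4 : Integrable (C.indicator D) μ :=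
        ((H.memLp_gap M i).integrable one_le_two).indicator₀ (hκm i)
      have b0 := hW2 i ω
      have b1 : |centredSum μ ξ (B'.indicator (l' - l)) ω| ≤ V ω := hV2 i ω
      have b2 : |centredSum μ ξ (C.indicator D) ω| ≤ U ω := hU2 i ω
      have b3 := abs_centredSum_le (ξ := ξ) i2 i4
        (fun s => indicator_nonneg (fun s _ => sub_nonneg.2 (H.state_mem M i s).1) s)
        (fun s => indicator_le_indicator (sub_le_sub_right (H.state_mem M i s).2 _)) ω
      have b4 : n * ∫ s, C.indicator D s ∂μ ≤ c :=
        H.mul_integral_gap_le hn M i fun s hs => (not_le.1 hs.2).le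
      have b5 : |centredSum μ ξ (B.indicator (g i - l)) ω| ≤
          |centredSum μ ξ (B'.indicator (l' - l)) ω| + (|centredSum μ ξ (C.indicator (g i - l)) ω| +
            |centredSum μ ξ (B'.indicator (g i - l')) ω|) := by
        rw [e, centredSum_add i1 (i2.add i3), centredSum_add i2 i3]
        exact (abs_add_le _ _).trans (add_le_add le_rfl (abs_add_le _ _))
      simp only [Pi.add_apply]
      linarith
    · rw [Finset.sum_range_succ, mul_add, ← add_assoc (√n * a)]
      have hs : 0 ≤ √n * a + 25 * ∑ p ∈ Finset.range M, √n * chainWidth a p * chainWeight q (p + 1) :=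
        add_nonneg (mul_nonneg (Real.sqrt_nonneg _) H.pos.le)
          (mul_nonneg (by norm_num) (Finset.sum_nonneg fun p _ => hterm p))
      have e : 25 * c = 8 * c + (16 * c + c) := by ring
      rw [← hc, e]
      refine eLpNorm_add_le_ofReal hW1 (hV1.add (hU1.add aestronglyMeasurable_const)) hs
        (by positivity) hW3 ?_
      refine eLpNorm_add_le_ofReal hV1 (hU1.add aestronglyMeasurable_const) (by positivity)
        (by positivity) hV3 ?_
      refine eLpNorm_add_le_ofReal hU1 aestronglyMeasurable_const (by positivity) hc0 hU3 ?_
      rw [eLpNorm_const c two_ne_zero (NeZero.ne P)]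
      simp [Real.enorm_of_nonneg hc0]

/-- Ossiander's bracketing inequality for a finite chain. The last term bounds the `n`-fold mean of
the width at which the chain stops; unlike at the earlier levels, no threshold is exceeded there, so
this mean has no bound of the order of `√n`. -/
theorem exists_dominating [Nonempty I] (H : IsBracketChain μ g F a β q)
    (hξ : IsIIDSample P μ ξ) (hn : 1 ≤ n) (M : ℕ) :
    ∃ W : Ω → ℝ, AEStronglyMeasurable W P ∧ (∀ i ω, |centredSum μ ξ (g i) ω| ≤ W ω) ∧
      eLpNorm W 2 P ≤ ENNReal.ofReal (√n * a +
        25 * ∑ p ∈ Finset.range (M + 1), √n * chainWidth a p * chainWeight q (p + 1) +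
        n * chainWidth a M) := by
  obtain ⟨W, hW1, hW2, hW3⟩ := H.exists_dominating_links hξ hn M
  obtain ⟨U, hU1, hU2, hU3⟩ := H.exists_dominating_gap hξ hn M Prod.snd
    (fun i => H.nullMeasurableSet_state M i) fun i => subset_rfl
  set t := chainThreshold a q n
  have hw := chainWidth_pos H.pos M
  have hg : ∀ i, MemLp (g i) 2 μ := H.memLp_class
  have hterm : ∀ p, 0 ≤ √n * chainWidth a p * chainWeight q (p + 1) :=
    H.mul_width_mul_weight_nonneg n
  refine ⟨W + (U + fun _ => n * chainWidth a M), hW1.add (hU1.add aestronglyMeasurable_const),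
    fun i ω => ?_, ?_⟩
  · have hBm : NullMeasurableSet (chainState F β t M i).2 μ := H.nullMeasurableSet_state M i
    have hD := H.memLp_gap (t := t) M i
    have b1 := hW2 i ω
    have b2 := hU2 i ω
    have b3 := abs_centredSum_le (ξ := ξ)
      ((((hg i).sub (H.memLp_state M i).1).integrable one_le_two).indicator₀ hBm)
      ((hD.integrable one_le_two).indicator₀ hBm)
      (fun s => indicator_nonneg (fun s _ => sub_nonneg.2 (H.state_mem M i s).1) s)
      (fun s => indicator_le_indicator (sub_le_sub_right (H.state_mem M i s).2 _)) ω
    have b4 : ∫ s, (chainState F β t M i).2.indicator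
        ((chainState F β t M i).1.2 - (chainState F β t M i).1.1) s ∂μ ≤ chainWidth a M := by
      have h1 : ∫ s, (chainState F β t M i).2.indicator
          ((chainState F β t M i).1.2 - (chainState F β t M i).1.1) s ∂μ ≤
          ∫ s, ((chainState F β t M i).1.2 - (chainState F β t M i).1.1) s ∂μ :=
        integral_mono ((hD.integrable one_le_two).indicator₀ hBm) (hD.integrable one_le_two)
          fun s => indicator_le_self' (fun s _ => H.gap_nonneg M i s) s
      refine h1.trans (abs_le_of_sq_le_sq' ?_ hw.le).2
      refine le_trans ?_ (integral_sq_le_of_eLpNorm_le hw.le (H.eLpNorm_gap_le (t := t) M i))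
      have h2 := variance_nonneg ((chainState F β t M i).1.2 - (chainState F β t M i).1.1) μ
      rw [variance_eq_sub hD] at h2
      simpa using h2
    have b5 : n * ∫ s, (chainState F β t M i).2.indicator
        ((chainState F β t M i).1.2 - (chainState F β t M i).1.1) s ∂μ ≤ n * chainWidth a M := by
      gcongr
    simp only [Pi.add_apply]
    linarith
  · have hs : 0 ≤ √n * a + 25 * ∑ p ∈ Finset.range M, √n * chainWidth a p * chainWeight q (p + 1) :=
      add_nonneg (mul_nonneg (Real.sqrt_nonneg _) H.pos.le)
        (mul_nonneg (by norm_num) (Finset.sum_nonneg fun p _ => hterm p))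
    have h0 := hterm M
    have hnw : 0 ≤ n * chainWidth a M := by positivity
    have h1 : eLpNorm (W + (U + fun _ => n * chainWidth a M)) 2 P ≤ _ :=
      eLpNorm_add_le_ofReal hW1 (hU1.add aestronglyMeasurable_const) hs
      (add_nonneg (mul_nonneg (by norm_num) h0) hnw) hW3
      (eLpNorm_add_le_ofReal hU1 aestronglyMeasurable_const (mul_nonneg (by norm_num) h0) hnw hU3
        (by
          rw [eLpNorm_const _ two_ne_zero (NeZero.ne P)]
          simp [Real.enorm_of_nonneg hnw]))
    refine h1.trans (ENNReal.ofReal_le_ofReal ?_)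
    rw [Finset.sum_range_succ]
    linarith

end IsBracketChain

/-! ### The entropy integral -/

/-- The integrand of `bracketingIntegral`, as a function of the bracketing number. -/
noncomputable def entropyRoot (Q : ℕ∞) : ℝ≥0∞ :=
  (1 + (ENNReal.log (Q : ℝ≥0∞)).toENNReal) ^ (1 / 2 : ℝ)

lemma entropyRoot_mono : Monotone entropyRoot := fun Q Q' h => by
  unfold entropyRoot
  gcongr
  exact EReal.toENNReal_le_toENNReal (ENNReal.log_monotone (by exact_mod_cast h))

lemma one_le_entropyRoot (Q : ℕ∞) : 1 ≤ entropyRoot Q :=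
  ENNReal.one_le_rpow le_self_add (by norm_num)

lemma entropyRoot_natCast {n : ℕ} (hn : 1 ≤ n) :
    entropyRoot n = ENNReal.ofReal √(1 + Real.log n) := by
  have h0 : (0 : ℝ) < n := by exact_mod_cast hn
  have hl : 0 ≤ Real.log n := Real.log_nonneg (by exact_mod_cast hn)
  have h1 : ((n : ℕ∞) : ℝ≥0∞) = ENNReal.ofReal n := by simp
  rw [entropyRoot, h1, ENNReal.log_ofReal_of_pos h0, EReal.toENNReal_of_ne_top (by simp),
    EReal.toReal_coe, ← ENNReal.ofReal_one, ← ENNReal.ofReal_add zero_le_one hl,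
    ENNReal.ofReal_rpow_of_nonneg (by positivity) (by norm_num), ← Real.sqrt_eq_rpow]

section

variable {I S : Type*} [MeasurableSpace S] {μ : Measure S} {f : I → S → ℝ}

lemma bracketingNumber_anti {𝓕 : Set (S → ℝ)} {ε ε' : ℝ≥0∞} (h : ε ≤ ε') :
    bracketingNumber μ ε' 𝓕 ≤ bracketingNumber μ ε 𝓕 := by
  refine sInf_le_sInf ?_
  rintro n ⟨T, hT, hb, hc⟩
  exact ⟨T, hT, fun b hb' => ⟨(hb b hb').1, (hb b hb').2.1, (hb b hb').2.2.trans_le h⟩, hc⟩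

lemma exists_finset_of_bracketingNumber_ne_top {𝓕 : Set (S → ℝ)} {ε : ℝ≥0∞}
    (h : bracketingNumber μ ε 𝓕 ≠ ⊤) :
    ∃ T : Finset ((S → ℝ) × (S → ℝ)), (T.card : ℕ∞) = bracketingNumber μ ε 𝓕 ∧
      (∀ b ∈ T, IsL2Bracket μ ε b) ∧
      ∀ g ∈ 𝓕, ∃ b ∈ T, ∀ s, b.1 s ≤ g s ∧ g s ≤ b.2 s := by
  refine csInf_mem (s := {n : ℕ∞ | ∃ T : Finset ((S → ℝ) × (S → ℝ)), (T.card : ℕ∞) = n ∧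
    (∀ b ∈ T, IsL2Bracket μ ε b) ∧
    ∀ g ∈ 𝓕, ∃ b ∈ T, ∀ s, b.1 s ≤ g s ∧ g s ≤ b.2 s}) ?_
  by_contra hne
  rw [not_nonempty_iff_eq_empty] at hne
  exact h (by rw [bracketingNumber, hne, sInf_empty])

lemma one_le_bracketingNumber {𝓕 : Set (S → ℝ)} (h𝓕 : 𝓕.Nonempty) (ε : ℝ≥0∞) :
    1 ≤ bracketingNumber μ ε 𝓕 := by
  refine le_sInf ?_
  rintro n ⟨T, rfl, -, hc⟩
  obtain ⟨g, hg⟩ := h𝓕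
  obtain ⟨b, hb, -⟩ := hc g hg
  exact_mod_cast Finset.card_pos.2 ⟨b, hb⟩

lemma one_le_toNat_bracketingNumber {𝓕 : Set (S → ℝ)} (h𝓕 : 𝓕.Nonempty) {ε : ℝ≥0∞}
    (h : bracketingNumber μ ε 𝓕 ≠ ⊤) : 1 ≤ (bracketingNumber μ ε 𝓕).toNat := by
  have := one_le_bracketingNumber (μ := μ) h𝓕 ε
  rw [← ENat.natCast_toNat h] at this
  exact_mod_cast this

lemma centredClass_nonempty [Nonempty I] : (centredClass μ f).Nonempty := range_nonempty _

lemma bracketingIntegral_eq (μ : Measure S) (f : I → S → ℝ) :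
    bracketingIntegral μ f = ∫⁻ v in Ioc (0 : ℝ) 1, entropyRoot
      (bracketingNumber μ (ENNReal.ofReal v * envelopeNorm μ f) (centredClass μ f)) := rfl

lemma one_le_bracketingIntegral (μ : Measure S) (f : I → S → ℝ) : 1 ≤ bracketingIntegral μ f := by
  rw [bracketingIntegral_eq]
  calc (1 : ℝ≥0∞) = ∫⁻ _ in Ioc (0 : ℝ) 1, 1 := by simp
    _ ≤ _ := lintegral_mono fun v => one_le_entropyRoot _

/-- The entropy integral dominates its lower Riemann sums over the dyadic points: the integrand is
antitone, and the interval `(2 ^ (-(r + 2)), 2 ^ (-(r + 1))]` has length `2 ^ (-(r + 2))`. -/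
lemma sum_le_bracketingIntegral (μ : Measure S) (f : I → S → ℝ) (M : ℕ) :
    ∑ r ∈ Finset.range M, entropyRoot (bracketingNumber μ
      (ENNReal.ofReal (1 / 2 ^ (r + 1)) * envelopeNorm μ f) (centredClass μ f)) *
        ENNReal.ofReal (1 / 2 ^ (r + 2)) ≤ bracketingIntegral μ f := by
  set e : ℝ → ℝ≥0∞ := fun v => entropyRoot
      (bracketingNumber μ (ENNReal.ofReal v * envelopeNorm μ f) (centredClass μ f))
  have he : ∀ v w, v ≤ w → e w ≤ e v := fun v w h =>
    entropyRoot_mono (bracketingNumber_anti (by gcongr))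
  have key : ∑ r ∈ Finset.range M, e (1 / 2 ^ (r + 1)) * ENNReal.ofReal (1 / 2 ^ (r + 2)) ≤
      ∫⁻ v in Ioc (1 / 2 ^ (M + 1) : ℝ) 1, e v := by
    induction M with
    | zero => simp
    | succ M ih =>
      have h1 : (1 / 2 ^ (M + 1 + 1) : ℝ) ≤ 1 / 2 ^ (M + 1) :=
        one_div_le_one_div_of_le (by positivity) (pow_le_pow_right₀ one_le_two (by omega))
      have h2 : (1 / 2 ^ (M + 1) : ℝ) ≤ 1 := by
        rw [div_le_one (by positivity)]; exact one_le_pow₀ one_le_two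
      have h3 : Disjoint (Ioc (1 / 2 ^ (M + 1 + 1) : ℝ) (1 / 2 ^ (M + 1)))
          (Ioc (1 / 2 ^ (M + 1)) 1) := by
        rw [Set.disjoint_left]
        intro v hv hv'
        exact absurd hv.2 (not_le.2 hv'.1)
      rw [Finset.sum_range_succ, ← Ioc_union_Ioc_eq_Ioc h1 h2,
        lintegral_union measurableSet_Ioc h3, add_comm]
      refine add_le_add ?_ ih
      have h4 : (1 / 2 ^ (M + 2) : ℝ) = 1 / 2 ^ (M + 1) - 1 / 2 ^ (M + 1 + 1) := by
        rw [pow_succ 2 (M + 1)]; field_simp; ring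
      calc e (1 / 2 ^ (M + 1)) * ENNReal.ofReal (1 / 2 ^ (M + 2))
          = ∫⁻ _ in Ioc (1 / 2 ^ (M + 1 + 1) : ℝ) (1 / 2 ^ (M + 1)), e (1 / 2 ^ (M + 1)) := by
            rw [setLIntegral_const, Real.volume_Ioc, ← h4]
        _ ≤ _ := setLIntegral_mono' measurableSet_Ioc fun v hv => he _ _ hv.2
  rw [bracketingIntegral_eq]
  exact key.trans (lintegral_mono_set (Ioc_subset_Ioc_left (by positivity)))

/-- If the logarithm of the bracketing number is `O(1 + 1 / ε)`, then the entropy integral is finite,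
and its product with the envelope norm stays bounded as long as the latter does. -/
lemma bracketingIntegral_le_of_exp_bound {A B a : ℝ} (hA : 0 ≤ A) (hB : 0 ≤ B) (ha : 0 < a)
    [Nonempty I] (henv : envelopeNorm μ f = ENNReal.ofReal a)
    (hQ : ∀ ε : ℝ, 0 < ε → ∃ n : ℕ, bracketingNumber μ (ENNReal.ofReal ε) (centredClass μ f) ≤ n ∧
      (n : ℝ) ≤ Real.exp (A + B / ε)) :
    bracketingIntegral μ f ≤ ENNReal.ofReal (1 + A + 2 * √(B / a)) := by
  have hint : IntervalIntegrable (fun v : ℝ => 1 + A + √(B / a) * v ^ (-(1 / 2) : ℝ)) volume 0 1 :=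
    intervalIntegrable_const.add
      ((intervalIntegral.intervalIntegrable_rpow' (by norm_num)).const_mul _)
  have hval : ∫ v in (0 : ℝ)..1, (1 + A + √(B / a) * v ^ (-(1 / 2) : ℝ)) =
      1 + A + 2 * √(B / a) := by
    rw [intervalIntegral.integral_add intervalIntegrable_const
      ((intervalIntegral.intervalIntegrable_rpow' (by norm_num)).const_mul _),
      intervalIntegral.integral_const_mul, integral_rpow (Or.inl (by norm_num))]
    norm_num
    ring
  rw [intervalIntegral.integral_of_le zero_le_one] at hval
  rw [bracketingIntegral_eq, ← hval, ofReal_integral_eq_lintegral_ofReal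
    ((intervalIntegrable_iff_integrableOn_Ioc_of_le zero_le_one).1 hint)
    ((ae_restrict_iff' measurableSet_Ioc).2 (ae_of_all _ fun v hv => by
      have := Real.rpow_nonneg hv.1.le (-(1 / 2) : ℝ)
      simp only [Pi.zero_apply]
      positivity))]
  refine setLIntegral_mono' measurableSet_Ioc fun v hv => ?_
  rw [henv, ← ENNReal.ofReal_mul hv.1.le]
  obtain ⟨n, hn, hn'⟩ := hQ (v * a) (mul_pos hv.1 ha)
  have hn1 : 1 ≤ n := by
    have := (one_le_bracketingNumber (μ := μ) (centredClass_nonempty (f := f))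
      (ENNReal.ofReal (v * a))).trans hn
    exact_mod_cast this
  refine (entropyRoot_mono hn).trans ?_
  rw [entropyRoot_natCast hn1]
  refine ENNReal.ofReal_le_ofReal ?_
  have hn0 : (0 : ℝ) < n := by exact_mod_cast hn1
  have hv0 := hv.1
  have hlog : Real.log n ≤ A + B / (v * a) := (Real.log_le_iff_le_exp hn0).2 hn'
  have hr : v ^ (-(1 / 2) : ℝ) = √(1 / v) := by
    rw [Real.rpow_neg hv0.le, ← Real.sqrt_eq_rpow, one_div, Real.sqrt_inv]
  rw [hr, ← Real.sqrt_mul (by positivity)]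
  refine Real.sqrt_le_iff.2 ⟨by positivity, ?_⟩
  have h1 : B / a * (1 / v) = B / (v * a) := by field_simp
  have h2 := Real.sq_sqrt (show 0 ≤ B / (v * a) by positivity)
  rw [h1]
  have h3 := Real.sqrt_nonneg (B / (v * a))
  nlinarith

end

/-! ### Lipschitz classes over a compact parameter set -/

lemma exists_net_card_le_exp {d : ℕ} {X : Set (EuclideanSpace ℝ (Fin d))} (hX : IsCompact X) :
    ∃ A B : ℝ, 0 ≤ A ∧ 0 ≤ B ∧ ∀ δ : ℝ, 0 < δ → ∃ T : Finset X,
      (∀ x : X, ∃ y ∈ T, dist x y ≤ δ) ∧ (T.card : ℝ) ≤ Real.exp (A + B / δ) := by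
  classical
  obtain ⟨R, hR0, hR⟩ := hX.isBounded.exists_pos_norm_le
  refine ⟨4 * d, 2 * d * R * (d + 1), by positivity, by positivity, fun δ hδ => ?_⟩
  set η := δ / (d + 1) with hη
  have hη0 : 0 < η := by positivity
  -- the cells of a cubic grid of mesh `η`
  set φ : X → Fin d → ℤ := fun x i => ⌊(x : EuclideanSpace ℝ (Fin d)) i / η⌋ with hφ
  set m : ℕ := ⌈R / η⌉₊ + 1 with hm
  have hmem : ∀ x, φ x ∈ Fintype.piFinset fun _ : Fin d => Finset.Icc (-(m : ℤ)) m := by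
    intro x
    rw [Fintype.mem_piFinset]
    intro i
    have h1 : |(x : EuclideanSpace ℝ (Fin d)) i| ≤ R :=
      (PiLp.norm_apply_le (x : EuclideanSpace ℝ (Fin d)) i).trans (hR _ x.2)
    have h2 : |(x : EuclideanSpace ℝ (Fin d)) i / η| ≤ m - 1 := by
      rw [abs_div, abs_of_pos hη0, hm]
      push_cast
      have := Nat.le_ceil (R / η)
      have h3 : |(x : EuclideanSpace ℝ (Fin d)) i| / η ≤ R / η := by gcongr
      linarith
    obtain ⟨h3, h4⟩ := abs_le.1 h2
    rw [Finset.mem_Icc]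
    constructor
    · refine Int.le_floor.2 ?_
      push_cast
      linarith
    · have : (⌊(x : EuclideanSpace ℝ (Fin d)) i / η⌋ : ℝ) ≤ m :=
        (Int.floor_le _).trans (by linarith)
      exact_mod_cast this
  have hsub : range φ ⊆ ↑(Fintype.piFinset fun _ : Fin d => Finset.Icc (-(m : ℤ)) m) := by
    rintro _ ⟨x, rfl⟩; exact hmem x
  have hfin : (range φ).Finite := (Finset.finite_toSet _).subset hsub
  by_cases hne : Nonempty X
  swap
  · exact ⟨∅, fun x => (hne ⟨x⟩).elim, by simp [Real.exp_nonneg]⟩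
  choose! ψ hψ using fun (c : Fin d → ℤ) (hc : c ∈ range φ) => hc
  refine ⟨hfin.toFinset.image ψ, fun x => ⟨ψ (φ x), ?_, ?_⟩, ?_⟩
  · exact Finset.mem_image_of_mem _ (by simp)
  · have h1 := hψ (φ x) (mem_range_self x)
    rw [Subtype.dist_eq, EuclideanSpace.dist_eq]
    have h2 : ∀ i, dist ((x : EuclideanSpace ℝ (Fin d)) i)
        ((ψ (φ x) : EuclideanSpace ℝ (Fin d)) i) ^ 2 ≤ η ^ 2 := fun i => by
      have h3 := Int.abs_sub_lt_one_of_floor_eq_floor (congrFun h1 i)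
      rw [← sub_div, abs_div, abs_of_pos hη0, div_lt_one hη0] at h3
      rw [dist_comm, Real.dist_eq]
      gcongr
    refine Real.sqrt_le_iff.2 ⟨hδ.le, (Finset.sum_le_sum fun i _ => h2 i).trans ?_⟩
    rw [Finset.sum_const, Finset.card_univ, Fintype.card_fin, nsmul_eq_mul]
    have h3 : δ = η * (d + 1) := by rw [hη]; field_simp
    rw [h3, mul_pow, mul_comm]
    gcongr
    nlinarith [(Nat.cast_nonneg d : (0 : ℝ) ≤ d)]
  · have h1 : ((hfin.toFinset.image ψ).card : ℝ) ≤ (2 * m + 1 : ℝ) ^ d := by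
      have h2 : (hfin.toFinset.image ψ).card ≤ (2 * m + 1) ^ d := by
        refine Finset.card_image_le.trans ?_
        refine (Finset.card_le_card (t := Fintype.piFinset fun _ : Fin d =>
          Finset.Icc (-(m : ℤ)) m) fun c hc => hsub (by simpa using hc)).trans ?_
        rw [Fintype.card_piFinset]
        simp only [Int.card_Icc, Finset.prod_const, Finset.card_univ, Fintype.card_fin]
        refine Nat.pow_le_pow_left ?_ d
        omega
      exact_mod_cast h2
    refine h1.trans ?_
    have hm2 : (m : ℝ) ≤ R / η + 2 := by
      rw [hm]; push_cast
      have := Nat.ceil_lt_add_one (show 0 ≤ R / η by positivity)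
      linarith
    calc (2 * m + 1 : ℝ) ^ d ≤ Real.exp (2 * m) ^ d := by
          gcongr; exact Real.add_one_le_exp _
      _ = Real.exp (d * (2 * m)) := by rw [← Real.exp_nat_mul]
      _ ≤ Real.exp (d * (2 * (R / η + 2))) := by gcongr
      _ = _ := by rw [hη]; congr 1; field_simp; ring

section

variable {I S : Type*} [MeasurableSpace S] {μ : Measure S} {f : I → S → ℝ}

/-- A supremum of a family that is continuous in its parameter is a supremum over a countable dense
set of parameters, hence measurable. -/
lemma measurable_iSup_enorm [TopologicalSpace I] [TopologicalSpace.SeparableSpace I] [Nonempty I]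
    (hm : ∀ x, Measurable (f x)) (hc : ∀ s, Continuous fun x => f x s) :
    Measurable fun s => ⨆ x, ‖f x s‖ₑ := by
  have : (fun s => ⨆ x, ‖f x s‖ₑ) = fun s => ⨆ n, ‖f (TopologicalSpace.denseSeq I n) s‖ₑ := by
    funext s
    refine le_antisymm (iSup_le fun x => ?_) (iSup_comp_le (fun x => ‖f x s‖ₑ) _)
    refine (TopologicalSpace.denseRange_denseSeq I).induction_on x
      (isClosed_le (hc s).enorm continuous_const) fun n =>
      le_iSup (fun n => ‖f (TopologicalSpace.denseSeq I n) s‖ₑ) n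
  rw [this]
  exact Measurable.iSup fun n => (hm _).enorm

lemma iSup_enorm_sq (φ : I → ℝ) : (⨆ x, ‖φ x‖ₑ) ^ 2 = ⨆ x, ‖φ x‖ₑ ^ 2 :=
  ENNReal.iSup_pow_of_ne_zero two_ne_zero _

lemma eLpNorm_le_of_iSup_sq {σ : ℝ} (hσ : 0 ≤ σ)
    (hv : ∫⁻ s, ⨆ x, ‖f x s‖ₑ ^ 2 ∂μ ≤ ENNReal.ofReal (σ ^ 2)) (x : I) :
    eLpNorm (f x) 2 μ ≤ ENNReal.ofReal σ := by
  rw [eLpNorm_two_le_ofReal_iff hσ]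
  exact (lintegral_mono fun s => le_iSup (fun x => ‖f x s‖ₑ ^ 2) x).trans hv

lemma enorm_integral_le_of_eLpNorm [IsProbabilityMeasure μ] {φ : S → ℝ}
    (hφ : AEStronglyMeasurable φ μ) {c : ℝ≥0∞} (h : eLpNorm φ 2 μ ≤ c) :
    ‖∫ s, φ s ∂μ‖ₑ ≤ c := by
  refine (enorm_integral_le_lintegral_enorm _).trans ?_
  rw [← eLpNorm_one_eq_lintegral_enorm]
  exact (eLpNorm_le_eLpNorm_of_exponent_le one_le_two hφ).trans h

/-- Centring at most doubles the envelope norm. -/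
lemma envelopeNorm_le [IsProbabilityMeasure μ] (hm : ∀ x, Measurable (f x)) {σ : ℝ} (hσ : 0 ≤ σ)
    (hv : ∫⁻ s, ⨆ x, ‖f x s‖ₑ ^ 2 ∂μ ≤ ENNReal.ofReal (σ ^ 2)) :
    envelopeNorm μ f ≤ ENNReal.ofReal (2 * σ) := by
  have hpt : ∀ s, (⨆ x, ‖f x s - ∫ t, f x t ∂μ‖ₑ) ^ 2 ≤
      2 * (⨆ x, ‖f x s‖ₑ ^ 2) + 2 * ENNReal.ofReal (σ ^ 2) := fun s => by
    have h1 : ⨆ x, ‖f x s - ∫ t, f x t ∂μ‖ₑ ≤ (⨆ x, ‖f x s‖ₑ) + ENNReal.ofReal σ := by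
      refine iSup_le fun x => (enorm_sub_le).trans ?_
      exact add_le_add (le_iSup (fun x => ‖f x s‖ₑ) x) (enorm_integral_le_of_eLpNorm
        (hm x).aestronglyMeasurable (eLpNorm_le_of_iSup_sq hσ hv x))
    have h2 := ENNReal.rpow_add_le_mul_rpow_add_rpow (⨆ x, ‖f x s‖ₑ) (ENNReal.ofReal σ)
      (one_le_two (α := ℝ))
    norm_num at h2
    rw [← mul_add, ← iSup_enorm_sq, ENNReal.ofReal_pow hσ]
    exact (pow_le_pow_left₀ (zero_le) h1 2).trans h2
  have hI : ∫⁻ s, (⨆ x, ‖f x s - ∫ t, f x t ∂μ‖ₑ) ^ 2 ∂μ ≤ ENNReal.ofReal ((2 * σ) ^ 2) := by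
    refine (lintegral_mono hpt).trans ?_
    rw [lintegral_add_right _ measurable_const, lintegral_const_mul' _ _ (by simp)]
    simp only [lintegral_const, measure_univ, mul_one]
    calc 2 * ∫⁻ s, ⨆ x, ‖f x s‖ₑ ^ 2 ∂μ + 2 * ENNReal.ofReal (σ ^ 2)
        ≤ 2 * ENNReal.ofReal (σ ^ 2) + 2 * ENNReal.ofReal (σ ^ 2) := by gcongr
      _ = ENNReal.ofReal ((2 * σ) ^ 2) := by
        rw [← add_mul, mul_pow, ENNReal.ofReal_mul (by positivity)]
        norm_num
  calc envelopeNorm μ f ≤ ENNReal.ofReal ((2 * σ) ^ 2) ^ (1 / 2 : ℝ) := by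
        unfold envelopeNorm; gcongr
    _ = ENNReal.ofReal (2 * σ) := by
        rw [ENNReal.ofReal_rpow_of_nonneg (by positivity) (by norm_num), ← Real.sqrt_eq_rpow,
          Real.sqrt_sq (by positivity)]

variable [PseudoMetricSpace I]

lemma continuous_of_abs_sub_le {K : ℝ} {φ : I → ℝ} (h : ∀ x y, |φ x - φ y| ≤ K * dist x y) :
    Continuous φ := by
  refine (LipschitzWith.of_dist_le' (K := K) fun x y => ?_).continuous
  rw [Real.dist_eq]; exact h x y

lemma abs_integral_sub_le {Ω : Type*} [MeasurableSpace Ω] {P : Measure Ω} [IsProbabilityMeasure P]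
    {K : ℝ} {φ : I → Ω → ℝ} (h : ∀ x y s, |φ x s - φ y s| ≤ K * dist x y)
    (hφ : ∀ x, Integrable (φ x) P) (x y : I) :
    |∫ s, φ x s ∂P - ∫ s, φ y s ∂P| ≤ K * dist x y := by
  rw [← integral_sub (hφ x) (hφ y), ← Real.norm_eq_abs]
  refine (norm_integral_le_of_norm_le_const (C := K * dist x y)
    (ae_of_all _ fun s => h x y s)).trans (by simp)

lemma abs_centred_sub_le [IsProbabilityMeasure μ] {K : ℝ}
    (hK : ∀ x y s, |f x s - f y s| ≤ K * dist x y) (hf : ∀ x, Integrable (f x) μ) (x y : I) (s : S) :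
    |(f x s - ∫ t, f x t ∂μ) - (f y s - ∫ t, f y t ∂μ)| ≤ 2 * K * dist x y := by
  have h1 := hK x y s
  have h2 := abs_integral_sub_le hK hf x y
  rw [abs_le] at h1 h2 ⊢
  constructor <;> linarith

/-- A net of the parameter set yields brackets of the class, of constant width. -/
lemma bracketingNumber_centredClass_le [IsProbabilityMeasure μ] {K : ℝ} (hK0 : 0 ≤ K)
    (hK : ∀ x y s, |f x s - f y s| ≤ K * dist x y) (hf : ∀ x, MemLp (f x) 2 μ) {A B : ℝ}
    (hnet : ∀ δ : ℝ, 0 < δ → ∃ T : Finset I,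
      (∀ x, ∃ y ∈ T, dist x y ≤ δ) ∧ (T.card : ℝ) ≤ Real.exp (A + B / δ)) {ε : ℝ} (hε : 0 < ε) :
    ∃ n : ℕ, bracketingNumber μ (ENNReal.ofReal ε) (centredClass μ f) ≤ n ∧
      (n : ℝ) ≤ Real.exp (A + B * (4 * K + 1) / ε) := by
  classical
  set δ := ε / (4 * K + 1) with hδ
  have hδ0 : 0 < δ := by positivity
  obtain ⟨T, hT, hcard⟩ := hnet δ hδ0
  have hKδ : 4 * K * δ < ε := by
    rw [hδ, mul_div_assoc', div_lt_iff₀ (by positivity)]; nlinarith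
  set c := 2 * K * δ with hc
  have hc0 : 0 ≤ c := by positivity
  set b : I → (S → ℝ) × (S → ℝ) := fun y =>
    (fun s => f y s - ∫ t, f y t ∂μ - c, fun s => f y s - ∫ t, f y t ∂μ + c) with hb
  refine ⟨(T.image b).card, sInf_le ⟨T.image b, rfl, ?_, ?_⟩, ?_⟩
  · intro p hp
    obtain ⟨y, -, rfl⟩ := Finset.mem_image.1 hp
    refine ⟨((hf y).sub (memLp_const _)).sub (memLp_const c),
      ((hf y).sub (memLp_const _)).add (memLp_const c), ?_⟩
    have : (b y).2 - (b y).1 = fun _ => 4 * K * δ := by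
      funext s; simp only [hb, Pi.sub_apply, hc]; ring
    rw [this, eLpNorm_const _ two_ne_zero (NeZero.ne μ)]
    simp only [measure_univ, ENNReal.one_rpow, mul_one]
    rw [Real.enorm_of_nonneg (by positivity)]
    exact (ENNReal.ofReal_lt_ofReal_iff hε).2 hKδ
  · rintro _ ⟨x, rfl⟩
    obtain ⟨y, hy, hxy⟩ := hT x
    refine ⟨b y, Finset.mem_image_of_mem _ hy, fun s => ?_⟩
    have h1 := abs_centred_sub_le hK (fun x => (hf x).integrable one_le_two) x y s
    have h2 : 2 * K * dist x y ≤ c := by rw [hc]; gcongr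
    obtain ⟨h3, h4⟩ := abs_le.1 (h1.trans h2)
    simp only [hb]
    constructor <;> linarith
  · have h1 : B / δ = B * (4 * K + 1) / ε := by rw [hδ]; field_simp
    rw [← h1]
    exact le_trans (by exact_mod_cast Finset.card_image_le) hcard

end

/-! ### The bracketing inequality for Lipschitz classes -/

lemma sum_chainWidth_mul_chainWeight (a : ℝ) (q : ℕ → ℝ) (M : ℕ) :
    ∑ p ∈ Finset.range M, chainWidth a p * chainWeight q (p + 1) + 2 * chainWidth a M * chainWeight q M
      = 4 * a + 16 * a * ∑ r ∈ Finset.range M, q r * (1 / 2 ^ (r + 2)) := by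
  induction M with
  | zero => simp [chainWidth, chainWeight]; ring
  | succ M ih =>
    have h1 : chainWeight q (M + 1) = chainWeight q M + q M := by
      unfold chainWeight; rw [Finset.sum_range_succ]; ring
    have h2 : chainWidth a M * q M * 2 = 16 * a * (q M * (1 / 2 ^ (M + 2))) := by
      unfold chainWidth; rw [pow_add]; field_simp; norm_num; ring
    rw [Finset.sum_range_succ, Finset.sum_range_succ, mul_add, ← add_assoc, ← ih, ← h2, h1,
      chainWidth_eq_two_mul_succ a M]
    ring

section

variable {I S : Type*} [MeasurableSpace S] {μ : Measure S} {f : I → S → ℝ} [PseudoMetricSpace I]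
  [CompactSpace I] [Nonempty I] [IsProbabilityMeasure μ]

lemma exists_isBracketChain (hm : ∀ x, Measurable (f x)) {K : ℝ}
    (hK : ∀ x y s, |f x s - f y s| ≤ K * dist x y) (hf : ∀ x, MemLp (f x) 2 μ) {a : ℝ} (ha : 0 < a)
    (henv : envelopeNorm μ f = ENNReal.ofReal a)
    (hQ : ∀ r : ℕ, bracketingNumber μ (ENNReal.ofReal (1 / 2 ^ (r + 1)) * envelopeNorm μ f)
      (centredClass μ f) ≠ ⊤) :
    ∃ F β, IsBracketChain μ (fun x s => f x s - ∫ t, f x t ∂μ) F a β fun r =>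
      √(1 + Real.log (bracketingNumber μ (ENNReal.ofReal (1 / 2 ^ (r + 1)) * envelopeNorm μ f)
        (centredClass μ f)).toNat) := by
  set g : I → S → ℝ := fun x s => f x s - ∫ t, f x t ∂μ
  have hgm : ∀ x, Measurable (g x) := fun x => (hm x).sub_const _
  have hgc : ∀ s, Continuous fun x => g x s := fun s =>
    continuous_of_abs_sub_le fun x y =>
      abs_centred_sub_le hK (fun x => (hf x).integrable one_le_two) x y s
  have hfin : ∀ s, ⨆ x, ‖g x s‖ₑ ≠ ⊤ := fun s => by
    obtain ⟨C, hC⟩ := (isCompact_range (hgc s)).isBounded.exists_norm_le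
    refine ne_top_of_le_ne_top (ENNReal.ofReal_ne_top (r := C)) (iSup_le fun x => ?_)
    rw [← ofReal_norm]
    exact ENNReal.ofReal_le_ofReal (hC _ (mem_range_self x))
  have hFm : Measurable fun s => (⨆ x, ‖g x s‖ₑ).toReal := (measurable_iSup_enorm hgm hgc).ennreal_toReal
  have hFn : eLpNorm (fun s => (⨆ x, ‖g x s‖ₑ).toReal) 2 μ = ENNReal.ofReal a := by
    rw [← henv]
    have h1 : ∀ s, ‖(⨆ x, ‖g x s‖ₑ).toReal‖ₑ = ⨆ x, ‖g x s‖ₑ := fun s => by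
      rw [Real.enorm_of_nonneg ENNReal.toReal_nonneg, ENNReal.ofReal_toReal (hfin s)]
    have h2 := eLpNorm_two_sq μ fun s => (⨆ x, ‖g x s‖ₑ).toReal
    simp_rw [h1] at h2
    unfold envelopeNorm
    rw [← h2, ← ENNReal.rpow_natCast, ← ENNReal.rpow_mul]
    norm_num
  choose T hT1 hT2 hT3 using fun r => exists_finset_of_bracketingNumber_ne_top (hQ r)
  choose β hβ1 hβ2 using fun r x => hT3 r (g x) ⟨x, rfl⟩
  have hsub : ∀ r, range (β r) ⊆ T r := fun r => by
    rintro _ ⟨x, rfl⟩; exact hβ1 r x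
  have hone : ∀ r, 1 ≤ (bracketingNumber μ (ENNReal.ofReal (1 / 2 ^ (r + 1)) * envelopeNorm μ f)
      (centredClass μ f)).toNat := fun r =>
    one_le_toNat_bracketingNumber centredClass_nonempty (hQ r)
  have hlog : ∀ r, 0 ≤ Real.log (bracketingNumber μ (ENNReal.ofReal (1 / 2 ^ (r + 1)) *
      envelopeNorm μ f) (centredClass μ f)).toNat := fun r =>
    Real.log_nonneg (by exact_mod_cast hone r)
  refine ⟨fun s => (⨆ x, ‖g x s‖ₑ).toReal, β, ha,
    ⟨hFm.aestronglyMeasurable, by rw [hFn]; exact ENNReal.ofReal_lt_top⟩, hFn.le, fun x s => ?_,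
    fun x => (hgm x).aestronglyMeasurable, fun r x => ?_, hβ2, fun r => ?_,
    fun r => (Finset.finite_toSet _).subset (hsub r), fun r => ?_⟩
  · have h1 := ENNReal.toReal_mono (hfin s) (le_iSup (fun x => ‖g x s‖ₑ) x)
    simpa using h1
  · have := hT2 r _ (hβ1 r x)
    rwa [henv, ← ENNReal.ofReal_mul (by positivity), one_div_mul_eq_div] at this
  · exact Real.one_le_sqrt.2 (by linarith [hlog r])
  · rw [Real.sq_sqrt (by linarith [hlog r])]
    have h0 : (0 : ℝ) < (bracketingNumber μ (ENNReal.ofReal (1 / 2 ^ (r + 1)) * envelopeNorm μ f)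
      (centredClass μ f)).toNat := by exact_mod_cast hone r
    have h1 : (range (β r)).ncard ≤ (bracketingNumber μ (ENNReal.ofReal (1 / 2 ^ (r + 1)) *
        envelopeNorm μ f) (centredClass μ f)).toNat := by
      rw [← hT1 r, ENat.toNat_natCast, ← ncard_coe_finset]
      exact ncard_le_ncard (hsub r) (Finset.finite_toSet _)
    calc ((range (β r)).ncard : ℝ) ≤ _ := by exact_mod_cast h1
      _ = Real.exp (Real.log _) := (Real.exp_log h0).symm
      _ ≤ _ := Real.exp_le_exp.2 (by linarith)

variable {Ω : Type*} [MeasurableSpace Ω] {P : Measure Ω} [IsProbabilityMeasure P] {n : ℕ}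
  {ξ : Fin n → Ω → S}

/-- The bracketing inequality. The last term of the bound stems from stopping the chain at the level
`M`; it vanishes as `M` grows. -/
theorem exists_dominating_of_lipschitz (hm : ∀ x, Measurable (f x)) {K : ℝ}
    (hK : ∀ x y s, |f x s - f y s| ≤ K * dist x y) (hf : ∀ x, MemLp (f x) 2 μ) {a : ℝ} (ha : 0 < a)
    (henv : envelopeNorm μ f = ENNReal.ofReal a)
    (hQ : ∀ ε : ℝ, 0 < ε → bracketingNumber μ (ENNReal.ofReal ε) (centredClass μ f) ≠ ⊤)
    (hJ : bracketingIntegral μ f ≠ ⊤) (hξ : IsIIDSample P μ ξ) (hn : 1 ≤ n) (M : ℕ) :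
    ∃ W : Ω → ℝ, AEStronglyMeasurable W P ∧ (∀ x ω, |centredSum μ ξ (f x) ω| ≤ W ω) ∧
      eLpNorm W 2 P ≤ ENNReal.ofReal (501 * √n * a * (bracketingIntegral μ f).toReal +
        n * (2 * a / 2 ^ M)) := by
  have hQ' : ∀ r : ℕ, bracketingNumber μ (ENNReal.ofReal (1 / 2 ^ (r + 1)) * envelopeNorm μ f)
      (centredClass μ f) ≠ ⊤ := fun r => by
    rw [henv, ← ENNReal.ofReal_mul (by positivity)]
    exact hQ _ (by positivity)
  obtain ⟨F, β, H⟩ := exists_isBracketChain hm hK hf ha henv hQ'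
  set q : ℕ → ℝ := fun r =>
      √(1 + Real.log (bracketingNumber μ (ENNReal.ofReal (1 / 2 ^ (r + 1)) * envelopeNorm μ f)
        (centredClass μ f)).toNat)
  obtain ⟨W, hW1, hW2, hW3⟩ := H.exists_dominating hξ hn M
  set J := (bracketingIntegral μ f).toReal
  have hJ1 : 1 ≤ J := by
    have := ENNReal.toReal_mono hJ (one_le_bracketingIntegral μ f)
    simpa using this
  have hsum : ∑ r ∈ Finset.range (M + 1), q r * (1 / 2 ^ (r + 2)) ≤ J := by
    refine (ENNReal.ofReal_le_iff_le_toReal hJ).1 (le_trans (le_of_eq ?_)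
      (sum_le_bracketingIntegral μ f (M + 1)))
    rw [ENNReal.ofReal_sum_of_nonneg fun r _ => by positivity]
    refine Finset.sum_congr rfl fun r _ => ?_
    rw [ENNReal.ofReal_mul (Real.sqrt_nonneg _), ← entropyRoot_natCast, ENat.natCast_toNat (hQ' r)]
    exact one_le_toNat_bracketingNumber centredClass_nonempty (hQ' r)
  refine ⟨W, hW1, fun x ω => ?_, hW3.trans (ENNReal.ofReal_le_ofReal ?_)⟩
  · have e : centredSum μ ξ (fun s => f x s - ∫ t, f x t ∂μ) ω = centredSum μ ξ (f x) ω := by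
      unfold centredSum
      rw [integral_sub ((hf x).integrable one_le_two) (integrable_const _)]
      simp
    rw [← e]; exact hW2 x ω
  · have h1 := sum_chainWidth_mul_chainWeight a q (M + 1)
    have h2 : 0 ≤ 2 * chainWidth a (M + 1) * chainWeight q (M + 1) := by
      have h3 := chainWidth_pos ha (M + 1)
      have h4 := H.one_le_weight (M + 1)
      positivity
    have h3 : ∑ p ∈ Finset.range (M + 1), chainWidth a p * chainWeight q (p + 1) ≤ 20 * (a * J) := by
      have h4 : a * ∑ r ∈ Finset.range (M + 1), q r * (1 / 2 ^ (r + 2)) ≤ a * J := by gcongr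
      have h5 : a * 1 ≤ a * J := by gcongr
      linarith
    have h4 : ∑ p ∈ Finset.range (M + 1), √n * chainWidth a p * chainWeight q (p + 1) ≤
        √n * (20 * (a * J)) := by
      simp_rw [mul_assoc, ← Finset.mul_sum]
      gcongr
    have h5 : √n * a * 1 ≤ √n * a * J := by gcongr
    have h6 : chainWidth a M = 2 * a / 2 ^ M := rfl
    rw [h6]
    linarith

end

/-! ### The optimal value of the sample average -/

lemma abs_iInf_sub_iInf_le {I : Type*} [Nonempty I] {u v : I → ℝ} {c : ℝ}
    (hv : BddBelow (range v)) (h : ∀ x, |u x - v x| ≤ c) : |(⨅ x, u x) - ⨅ x, v x| ≤ c := by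
  obtain ⟨b, hb⟩ := hv
  have hu : BddBelow (range u) := by
    refine ⟨b - c, ?_⟩
    rintro _ ⟨x, rfl⟩
    have h1 := hb (mem_range_self x)
    have h2 := (abs_le.1 (h x)).1
    linarith
  rw [abs_le]
  constructor
  · have : (⨅ x, v x) - c ≤ ⨅ x, u x := le_ciInf fun x => by
      have h1 := ciInf_le ⟨b, hb⟩ x
      have h2 := (abs_le.1 (h x)).1
      linarith
    linarith
  · have : (⨅ x, u x) - c ≤ ⨅ x, v x := le_ciInf fun x => by
      have h1 := ciInf_le hu x
      have h2 := (abs_le.1 (h x)).2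
      linarith
    linarith

lemma abs_saaValue_sub_optimalValue_le {Ω I S : Type*} [MeasurableSpace Ω] [MeasurableSpace S]
    [Nonempty I] {P : Measure Ω} {μ : Measure S} {f : I → S → ℝ} {ζ : Ω → S} {n : ℕ} (hn : 1 ≤ n)
    {ξ : Fin n → Ω → S} {ω : Ω} {c w : ℝ} (hbdd : BddBelow (range fun x => ∫ ω, f x (ζ ω) ∂P))
    (hbias : ∀ x, |∫ s, f x s ∂μ - ∫ ω, f x (ζ ω) ∂P| ≤ c)
    (hw : ∀ x, |centredSum μ ξ (f x) ω| ≤ w) :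
    |saaValue f ξ ω - optimalValue P f ζ| ≤ c + 1 / n * w := by
  refine abs_iInf_sub_iInf_le hbdd fun x => ?_
  have hn0 : (0 : ℝ) < n := by exact_mod_cast hn
  have e : 1 / (n : ℝ) * ∑ k, f x (ξ k ω) - ∫ ω, f x (ζ ω) ∂P =
      (∫ s, f x s ∂μ - ∫ ω, f x (ζ ω) ∂P) + 1 / n * centredSum μ ξ (f x) ω := by
    simp only [centredSum, Finset.sum_sub_distrib, Finset.sum_const, Finset.card_univ,
      Fintype.card_fin, nsmul_eq_mul]
    field_simp
    ring
  rw [e]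
  refine (abs_add_le _ _).trans (add_le_add (hbias x) ?_)
  rw [abs_mul, abs_of_pos (by positivity : 0 < 1 / (n : ℝ))]
  gcongr
  exact hw x

section

variable {Ω I S : Type*} [MeasurableSpace Ω] [MeasurableSpace S] [PseudoMetricSpace I]
  [CompactSpace I] [Nonempty I] {P : Measure Ω} [IsProbabilityMeasure P] {μ : Measure S}
  [IsProbabilityMeasure μ] {f : I → S → ℝ} {ζ : Ω → S} {n : ℕ} {ξ : Fin n → Ω → S}

/-- The root mean square error of the sample average optimal value, for a class with a nonzero
envelope. -/
lemma eLpNorm_saaValue_sub_le (hm : ∀ x, Measurable (f x)) {K : ℝ}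
    (hK : ∀ x y s, |f x s - f y s| ≤ K * dist x y) (hf : ∀ x, MemLp (f x) 2 μ) {a : ℝ} (ha : 0 < a)
    (henv : envelopeNorm μ f = ENNReal.ofReal a)
    (hQ : ∀ ε : ℝ, 0 < ε → bracketingNumber μ (ENNReal.ofReal ε) (centredClass μ f) ≠ ⊤)
    (hJ : bracketingIntegral μ f ≠ ⊤) (hξ : IsIIDSample P μ ξ) (hn : 1 ≤ n) {c : ℝ} (hc : 0 ≤ c)
    (hbdd : BddBelow (range fun x => ∫ ω, f x (ζ ω) ∂P))
    (hbias : ∀ x, |∫ s, f x s ∂μ - ∫ ω, f x (ζ ω) ∂P| ≤ c) :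
    eLpNorm (fun ω => saaValue f ξ ω - optimalValue P f ζ) 2 P ≤
      ENNReal.ofReal (c + 501 * (a * (bracketingIntegral μ f).toReal) / √n) := by
  set J := (bracketingIntegral μ f).toReal
  have hJ0 : 0 ≤ J := ENNReal.toReal_nonneg
  have hn0 : (0 : ℝ) < n := by exact_mod_cast hn
  have hM : ∀ M : ℕ, eLpNorm (fun ω => saaValue f ξ ω - optimalValue P f ζ) 2 P ≤
      ENNReal.ofReal (c + 501 * (a * J) / √n + 2 * a * (1 / 2) ^ M) := fun M => by
    obtain ⟨W, hW1, hW2, hW3⟩ := exists_dominating_of_lipschitz hm hK hf ha henv hQ hJ hξ hn M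
    have hd : 0 ≤ 501 * √n * a * J + n * (2 * a / 2 ^ M) := by positivity
    have h1 : eLpNorm (fun ω => saaValue f ξ ω - optimalValue P f ζ) 2 P ≤
        eLpNorm ((fun _ => c) + fun ω => 1 / (n : ℝ) * W ω) 2 P :=
      eLpNorm_mono_real fun ω =>
        abs_saaValue_sub_optimalValue_le hn hbdd hbias fun x => hW2 x ω
    have h2 : eLpNorm (fun ω => 1 / (n : ℝ) * W ω) 2 P ≤
        ENNReal.ofReal (1 / n * (501 * √n * a * J + n * (2 * a / 2 ^ M))) := by
      have h3 : eLpNorm (fun ω => 1 / (n : ℝ) * W ω) 2 P = _ :=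
        eLpNorm_const_smul (1 / (n : ℝ)) W 2 P
      rw [h3, ENNReal.ofReal_mul (by positivity), Real.enorm_of_nonneg (by positivity)]
      gcongr
    have h4 : eLpNorm (fun _ : Ω => c) 2 P ≤ ENNReal.ofReal c := by
      rw [eLpNorm_const _ two_ne_zero (NeZero.ne P)]
      simp [Real.enorm_of_nonneg hc]
    refine h1.trans ((eLpNorm_add_le_ofReal aestronglyMeasurable_const (hW1.const_mul _) hc
      (by positivity) h4 h2).trans (le_of_eq ?_))
    congr 1
    have hsq : (√n : ℝ) * √n = n := Real.mul_self_sqrt hn0.le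
    have hs0 : (0 : ℝ) < √n := Real.sqrt_pos.2 hn0
    have e : 501 * (a * J) / √n = 1 / n * (501 * √n * a * J) := by
      have hinv : 1 / (n : ℝ) = 1 / √n * (1 / √n) := by rw [one_div_mul_one_div, hsq]
      rw [hinv]; field_simp
    rw [e, one_div_pow]
    field_simp
    ring
  have hlim : Filter.Tendsto
      (fun M : ℕ => ENNReal.ofReal (c + 501 * (a * J) / √n + 2 * a * (1 / 2) ^ M)) Filter.atTop
      (nhds (ENNReal.ofReal (c + 501 * (a * J) / √n + 2 * a * 0))) :=
    ENNReal.tendsto_ofReal (tendsto_const_nhds.add (tendsto_const_nhds.mul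
      (tendsto_pow_atTop_nhds_zero_of_lt_one (by norm_num) (by norm_num))))
  rw [mul_zero, add_zero] at hlim
  exact ge_of_tendsto' hlim hM

/-- If the envelope vanishes, then almost surely every sample average equals its mean. -/
lemma eLpNorm_saaValue_sub_le_of_envelopeNorm_eq_zero (hm : ∀ x, Measurable (f x)) {K : ℝ}
    (hK : ∀ x y s, |f x s - f y s| ≤ K * dist x y) (hf : ∀ x, MemLp (f x) 2 μ)
    (henv : envelopeNorm μ f = 0) (hξ : IsIIDSample P μ ξ) (hn : 1 ≤ n) {c : ℝ}
    (hbdd : BddBelow (range fun x => ∫ ω, f x (ζ ω) ∂P))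
    (hbias : ∀ x, |∫ s, f x s ∂μ - ∫ ω, f x (ζ ω) ∂P| ≤ c) :
    eLpNorm (fun ω => saaValue f ξ ω - optimalValue P f ζ) 2 P ≤ ENNReal.ofReal c := by
  have hgm : Measurable fun s => ⨆ x, ‖f x s - ∫ t, f x t ∂μ‖ₑ :=
    measurable_iSup_enorm (f := fun x s => f x s - ∫ t, f x t ∂μ) (fun x => (hm x).sub_const _)
      fun s => continuous_of_abs_sub_le fun x y =>
        abs_centred_sub_le hK (fun x => (hf x).integrable one_le_two) x y s
  have h0 : ∀ᵐ s ∂μ, ∀ x, f x s - ∫ t, f x t ∂μ = 0 := by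
    unfold envelopeNorm at henv
    rw [ENNReal.rpow_eq_zero_iff_of_pos (by norm_num), lintegral_eq_zero_iff (hgm.pow_const 2)] at henv
    filter_upwards [henv] with s hs x
    have h1 : ⨆ x, ‖f x s - ∫ t, f x t ∂μ‖ₑ = 0 := by simpa using hs
    simpa using (ENNReal.iSup_eq_zero.1 h1) x
  have h1 : ∀ᵐ ω ∂P, ∀ k x, f x (ξ k ω) - ∫ t, f x t ∂μ = 0 := by
    rw [ae_all_iff]
    intro k
    rw [← hξ.map_eq k] at h0
    have := ae_of_ae_map (hξ.aemeasurable k) h0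
    rwa [hξ.map_eq k] at this
  refine (eLpNorm_le_of_ae_bound (C := c) ?_).trans (by simp)
  filter_upwards [h1] with ω hω
  have := abs_saaValue_sub_optimalValue_le (w := 0) hn hbdd hbias (ξ := ξ) (ω := ω) fun x => by
    simp [centredSum, hω]
  simpa using this

end

theorem theorem5 :
    ∃ C : ℝ, 0 < C ∧
      ∀ (Ω : Type*) [MeasurableSpace Ω] (P : Measure Ω) [IsProbabilityMeasure P]
        (d m : ℕ) (X : Set (EuclideanSpace ℝ (Fin d))) (Θ : Set (EuclideanSpace ℝ (Fin m)))
        (f : X → Θ → ℝ) (Lf : ℝ) (B : Set ℝ) (ζ : Ω → Θ) (ζh : ℝ → Ω → Θ),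
        IsCompact X → X.Nonempty →
        (∀ x, Measurable (f x)) →
        (∀ h ∈ B, 0 < h) →
        Measurable ζ → (∀ h ∈ B, Measurable (ζh h)) →
        (∀ x, Integrable (fun ω => f x (ζ ω)) P) →
        -- Lipschitz assumption
        (∀ (x₁ x₂ : X) (θ : Θ), |f x₁ θ - f x₂ θ| ≤ Lf * ‖(x₁ : EuclideanSpace ℝ (Fin d)) - x₂‖) →
        -- variance assumption
        sigmaSq P f B ζh < ⊤ →
        (∀ h ∈ B, envelopeNorm (P.map (ζh h)) f ≠ 0 →
          bracketingIntegral (P.map (ζh h)) f < ⊤) ∧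
        ∃ c₃ : ℝ, 0 ≤ c₃ ∧
          ∀ h ∈ B, ∀ c₁ α : ℝ, 0 < α →
            -- bias assumption
            (∀ x, |∫ ω, (f x (ζh h ω) - f x (ζ ω)) ∂P| ≤ c₁ * h ^ α) →
            ∀ N : ℕ, 1 ≤ N → ∀ ξ : Fin N → Ω → Θ,
              iIndepFun ξ P → (∀ k, IdentDistrib (ξ k) (ζh h) P P) →
              eLpNorm (fun ω => saaValue f ξ ω - optimalValue P f ζ) 2 P ≤
                  ENNReal.ofReal (c₁ * h ^ α + c₃ * (√(sigmaSq P f B ζh).toReal / √N)) ∧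
              (envelopeNorm (P.map (ζh h)) f ≠ 0 →
                eLpNorm (fun ω => saaValue f ξ ω - optimalValue P f ζ) 2 P ≤
                  ENNReal.ofReal (c₁ * h ^ α +
                    C * (bracketingIntegral (P.map (ζh h)) f).toReal *
                      (√(sigmaSq P f B ζh).toReal / √N))) := by
  refine ⟨1002, by norm_num, ?_⟩
  intro Ω _ P _ d m X Θ f Lf B ζ ζh hX hXne hm hB hζ hζh hint hLip hσ
  have : CompactSpace X := isCompact_iff_compactSpace.1 hX
  have : Nonempty X := hXne.to_subtype
  set K := |Lf|
  have hK0 : 0 ≤ K := abs_nonneg _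
  have hK : ∀ x y s, |f x s - f y s| ≤ K * dist x y := fun x y s => by
    refine (hLip x y s).trans ?_
    rw [Subtype.dist_eq, dist_eq_norm]
    gcongr
    exact le_abs_self _
  have hfc : ∀ s, Continuous fun x => f x s := fun s => continuous_of_abs_sub_le fun x y => hK x y s
  set σ := √(sigmaSq P f B ζh).toReal with hσdef
  have hσ0 : 0 ≤ σ := Real.sqrt_nonneg _
  have hσ2 : ENNReal.ofReal (σ ^ 2) = sigmaSq P f B ζh := by
    rw [hσdef, Real.sq_sqrt ENNReal.toReal_nonneg, ENNReal.ofReal_toReal hσ.ne]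
  have hprob : ∀ h ∈ B, IsProbabilityMeasure (P.map (ζh h)) := fun h hh =>
    Measure.isProbabilityMeasure_map (hζh h hh).aemeasurable
  have hv : ∀ h ∈ B, ∫⁻ s, ⨆ x, ‖f x s‖ₑ ^ 2 ∂(P.map (ζh h)) ≤ ENNReal.ofReal (σ ^ 2) := by
    intro h hh
    have hmeas : Measurable fun s => ⨆ x, ‖f x s‖ₑ ^ 2 := by
      simp_rw [← iSup_enorm_sq]
      exact (measurable_iSup_enorm hm hfc).pow_const 2
    rw [lintegral_map hmeas (hζh h hh), hσ2]
    exact le_iSup₂ (f := fun h (_ : h ∈ B) => ∫⁻ ω, ⨆ x, ‖f x (ζh h ω)‖ₑ ^ 2 ∂P) h hh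
  have hf : ∀ h ∈ B, ∀ x, MemLp (f x) 2 (P.map (ζh h)) := fun h hh x =>
    ⟨(hm x).aestronglyMeasurable,
      (eLpNorm_le_of_iSup_sq hσ0 (hv h hh) x).trans_lt ENNReal.ofReal_lt_top⟩
  obtain ⟨A, B', hA, hB', hnet⟩ := exists_net_card_le_exp hX
  set D := B' * (4 * K + 1)
  have hD0 : 0 ≤ D := by positivity
  have hbr : ∀ h ∈ B, ∀ ε : ℝ, 0 < ε → ∃ n : ℕ, bracketingNumber (P.map (ζh h)) (ENNReal.ofReal ε)
      (centredClass (P.map (ζh h)) f) ≤ n ∧ (n : ℝ) ≤ Real.exp (A + D / ε) := fun h hh ε hε => by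
    have := hprob h hh
    exact bracketingNumber_centredClass_le hK0 hK (hf h hh) hnet hε
  have henv : ∀ h ∈ B, ∃ a, 0 ≤ a ∧ a ≤ 2 * σ ∧
      envelopeNorm (P.map (ζh h)) f = ENNReal.ofReal a := fun h hh => by
    have := hprob h hh
    have h1 := envelopeNorm_le hm hσ0 (hv h hh)
    exact ⟨_, ENNReal.toReal_nonneg, ENNReal.toReal_le_of_le_ofReal (by positivity) h1,
      (ENNReal.ofReal_toReal (ne_top_of_le_ne_top ENNReal.ofReal_ne_top h1)).symm⟩
  have hJ : ∀ h ∈ B, ∀ a, 0 < a → envelopeNorm (P.map (ζh h)) f = ENNReal.ofReal a →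
      bracketingIntegral (P.map (ζh h)) f ≤ ENNReal.ofReal (1 + A + 2 * √(D / a)) :=
    fun h hh a ha he => bracketingIntegral_le_of_exp_bound hA hD0 ha he (hbr h hh)
  have hbdd : BddBelow (range fun x => ∫ ω, f x (ζ ω) ∂P) :=
    (isCompact_range (continuous_of_abs_sub_le fun x y =>
      abs_integral_sub_le (fun x y ω => hK x y (ζ ω)) hint x y)).bddBelow
  -- `E` bounds the product of the envelope norm and the entropy integral for every `h`
  set E := (1 + A) * (2 * σ) + 2 * √(D * (2 * σ)) with hE
  have hE0 : 0 ≤ E := by positivity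
  have haJ : ∀ h ∈ B, ∀ a, 0 < a → a ≤ 2 * σ → envelopeNorm (P.map (ζh h)) f = ENNReal.ofReal a →
      a * (bracketingIntegral (P.map (ζh h)) f).toReal ≤ E := fun h hh a ha haσ he => by
    have h1 : (bracketingIntegral (P.map (ζh h)) f).toReal ≤ 1 + A + 2 * √(D / a) :=
      ENNReal.toReal_le_of_le_ofReal (by positivity) (hJ h hh a ha he)
    have h2 : a * √(D / a) = √(D * a) := by
      rw [show D * a = a ^ 2 * (D / a) by field_simp, Real.sqrt_mul (by positivity),
        Real.sqrt_sq ha.le]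
    calc a * (bracketingIntegral (P.map (ζh h)) f).toReal ≤ a * (1 + A + 2 * √(D / a)) := by gcongr
      _ = (1 + A) * a + 2 * √(D * a) := by rw [← h2]; ring
      _ ≤ E := by rw [hE]; gcongr
  refine ⟨fun h hh hne => ?_, 501 * E / σ, by positivity, ?_⟩
  · obtain ⟨a, ha0, -, he⟩ := henv h hh
    have ha : 0 < a := by
      rw [he] at hne
      exact ENNReal.ofReal_pos.1 (pos_iff_ne_zero.2 hne)
    exact (hJ h hh a ha he).trans_lt ENNReal.ofReal_lt_top
  intro h hh c₁ α hα hbias N hN ξ hind hid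
  have := hprob h hh
  have hξ : IsIIDSample P (P.map (ζh h)) ξ :=
    ⟨fun k => (hid k).aemeasurable_fst, fun k => (hid k).map_eq, hind⟩
  have hbias' : ∀ x, |∫ s, f x s ∂(P.map (ζh h)) - ∫ ω, f x (ζ ω) ∂P| ≤ c₁ * h ^ α := fun x => by
    rw [integral_map (hζh h hh).aemeasurable (hm x).aestronglyMeasurable, ← integral_sub _ (hint x)]
    · exact hbias x
    · exact ((hf h hh x).integrable one_le_two).comp_aemeasurable (hζh h hh).aemeasurable
  have hc : 0 ≤ c₁ * h ^ α := (abs_nonneg _).trans (hbias' (Classical.arbitrary X))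
  have hsN : 0 < √(N : ℝ) := Real.sqrt_pos.2 (by exact_mod_cast hN)
  obtain ⟨a, ha0, haσ, he⟩ := henv h hh
  by_cases hne : envelopeNorm (P.map (ζh h)) f = 0
  · refine ⟨?_, fun h0 => absurd hne h0⟩
    refine (eLpNorm_saaValue_sub_le_of_envelopeNorm_eq_zero hm hK (hf h hh) hne hξ hN hbdd
      hbias').trans (ENNReal.ofReal_le_ofReal ?_)
    have : 0 ≤ 501 * E / σ * (σ / √N) := by positivity
    linarith
  have ha : 0 < a := by
    rw [he] at hne
    exact ENNReal.ofReal_pos.1 (pos_iff_ne_zero.2 hne)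
  have hσpos : 0 < σ := by linarith
  have main := eLpNorm_saaValue_sub_le (ζ := ζ) hm hK (hf h hh) ha he
    (fun ε hε => by
      obtain ⟨n, hn, -⟩ := hbr h hh ε hε
      exact ne_top_of_le_ne_top (ENat.natCast_ne_top n) hn)
    ((hJ h hh a ha he).trans_lt ENNReal.ofReal_lt_top).ne hξ hN hc hbdd hbias'
  refine ⟨main.trans (ENNReal.ofReal_le_ofReal ?_), fun _ => main.trans (ENNReal.ofReal_le_ofReal ?_)⟩
  · have e : 501 * E / σ * (σ / √N) = 501 * E / √N := by field_simp
    rw [e]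
    have := haJ h hh a ha haσ he
    gcongr
  · set J := (bracketingIntegral (P.map (ζh h)) f).toReal
    have hJ0 : 0 ≤ J := ENNReal.toReal_nonneg
    have e : 1002 * J * (σ / √N) = 501 * (2 * σ * J) / √N := by field_simp; ring
    rw [e]
    gcongr
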